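/- **Lemma 1.** *Channel model.* Users are indexed by $l$; user $l$ has finitely many rays $r=(c,s)$ ($1\le c\le C$, $1\le s\le S$) with deterministic powers $\beta^{(l)}_r\ge 0$, phases $\Theta^{(l)}_r\sim\mathcal U[0,2\pi]$, azimuth angles $\phi^{(l)}_r$ and elevation angles $\theta^{(l)}_r$, the latter measured from the $z$-axis, and channel vector $\mathbf h_l=\sum_r\sqrt{\beta^{(l)}_r}\,e^{j\Theta^{(l)}_r}\,\mathbf a(\phi^{(l)}_r,\theta^{(l)}_r)\in\mathbb C^M$, where $\mathbf a$ is the steering vector of the array. The phases are mutually independent and jointly independent of the angles. All azimuth angles have the same law; all elevation angles have the same law, which has a density and is supported in $[0,\pi]$. For any ray of one user and any ray of another user, the two azimuths and two elevations are mutually independent. Put $\beta^{(l)}=\sum_r\beta^{(l)}_r$. For $l\ne l'$ with $\beta^{(l)},\beta^{(l')}>0$ the normalised mean interference is $$\kappa=\frac{\mathbb E\,|\mathbf h_l^{\mathrm H}\mathbf h_{l'}|^2}{M^2\beta^{(l)}\beta^{(l')}} .$$ *Arrays.* Number antennas from $0$. The uniform cylindrical array (UCylA) with $M_r\ge2$,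 $M_z\ge1$, $M=M_rM_z$ has $$\mathbf a(\phi,\theta)_{(m_r,m_z)}=e^{j\frac{\pi d_r}{\sin(\pi/M_r)}\sin\theta\cos(\phi-\Psi_{m_r})}\,e^{j2\pi d_zm_z\cos\theta},\qquad \Psi_m=2\pi m/M_r .$$ The vertical uniform rectangular array (VURA) with $M_y,M_z\ge1$, $M=M_yM_z$ has $$\mathbf a(\phi,\theta)_{(m_y,m_z)}=e^{j2\pi d_ym_y\sin\theta\sin\phi}\,e^{j2\pi d_zm_z\cos\theta}.$$ *Series.* Let $\psi(n)=\mathbb E[e^{jn\phi}]$ be the characteristic function of the azimuth and $\chi(n)=\mathbb E[e^{jn(\theta-\pi/2)}]$ that of the elevation relative to broadside $\theta=\pi/2$. Let $p(n)=\min(n,0)$, let $J_\nu$ be the Bessel function of the first kind, and for real $A,z_1,z_2$ let $$V(A,z_1,z_2)=\sum_{n=-\infty}^{\infty}(-1)^{p(n)}e^{jnA}\psi(n)\sum_{n'=-\infty}^{\infty}\chi(2n')\sum_{\hat n=-\infty}^{\infty}J_{\frac{|n|}2-\hat n}\!\left(\tfrac{z_1}2\right)J_{\frac{|n|}2+\hat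 n}\!\left(\tfrac{z_1}2\right)G(n,n',\hat n,z_2),$$ $$G(n,n',\hat n,z_2)=J_{2(n'+\hat n)}(z_2)+\frac4\pi\sum_{\hat n'=1}^{\infty}(-1)^{\hat n'-n'-\hat n}\,\frac{J_{2\hat n'-1}(z_2)\,2(n'+\hat n)}{(2\hat n'-1)^2-4(n'+\hat n)^2}.$$ Here the sum over $n'$ is the limit of its symmetric partial sums $\sum_{|n'|\le N}$, the principal branch of $(z/2)^\nu$ is used in $J_\nu(z)$, and for $z_1=0$ the product of the two Bessel functions is read as its limit as $z_1\to0$. *Claim.* For all real $A,z_1,z_2$ all these series converge (those over $n$, $\hat n$ and $\hat n'$ absolutely). For the UCylA, with any real $d_r,d_z$, the expectation in $\kappa$ is finite and $$\kappa^{\mathrm{UCylA}}=\frac1{M^2}\sum_{m_r,m_r'=0}^{M_r-1}\ \sum_{m_z,m_z'=0}^{M_z-1}|V(A,z_1,z_2)|^2,$$ where $a=\sin\Psi_{m_r}-\sin\Psi_{m_r'}$, $b=\cos\Psi_{m_r}-\cos\Psi_{m_r'}$, $A=\arctan(b/a)$ (with $A=\pm\pi/2$, the sign being that of $b$, if $a=0\ne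 b$, and $A=0$ if $a=b=0$), $z_1=\sqrt{a^2+b^2}\,\pi d_r/\sin(\pi/M_r)$ and $z_2=2\pi d_z(m_z-m_z')$. For the VURA, with any real $d_y,d_z$, the expectation in $\kappa$ is finite and $$\kappa^{\mathrm{VURA}}=\frac1{M^2}\sum_{m_y,m_y'=0}^{M_y-1}\ \sum_{m_z,m_z'=0}^{M_z-1}|V(0,z_1,z_2)|^2,\qquad z_1=2\pi d_y(m_y-m_y'),\quad z_2=2\pi d_z(m_z-m_z').$$ -/

import Mathlib

open MeasureTheory ProbabilityTheory SummationFilter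

/-- The Bessel function of the first kind `J_ν(z)` of real order `ν`, by its power series, with the
principal branch of `(z/2)^ν`. At the poles of `Γ` Mathlib has `Γ = 0`, hence `1 / Γ = 0` as it
should be, so that negative integer orders are covered. -/
noncomputable def besselJ (ν : ℝ) (z : ℂ) : ℂ :=
  (z / 2) ^ (ν : ℂ) *
    ∑' m : ℕ, (-1) ^ m / ((Nat.factorial m : ℂ) * Complex.Gamma (m + ν + 1)) * (z / 2) ^ (2 * m)

/-- A ray-based channel model for `L` users, each with `C` scattering clusters of `S` subrays; a ray
of a user is indexed by `(c, s) : Fin C × Fin S`. The azimuth angles of arrival have the common law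
`μ` and the elevation angles of arrival (measured from the `z`-axis) the common law `ν`.
Angles of different rays of one user may be dependent (as they are when the rays of a cluster share
a random central angle); the angles of a ray of one user and of a ray of another user are
independent. -/
structure RayModel {Ω : Type*} [MeasurableSpace Ω] (P : Measure Ω) (μ ν : Measure ℝ)
    (L C S : ℕ) where
  /-- ray powers -/
  power : Fin L → Fin C × Fin S → ℝ
  /-- ray phases -/
  phase : Fin L → Fin C × Fin S → Ω → ℝ
  /-- azimuth angles of arrival -/
  azimuth : Fin L → Fin C × Fin S → Ω → ℝ
  /-- elevation angles of arrival -/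
  elevation : Fin L → Fin C × Fin S → Ω → ℝ
  power_nonneg : ∀ l r, 0 ≤ power l r
  measurable_phase : ∀ l r, Measurable (phase l r)
  measurable_azimuth : ∀ l r, Measurable (azimuth l r)
  measurable_elevation : ∀ l r, Measurable (elevation l r)
  phase_uniform : ∀ l r, pdf.IsUniform (phase l r) (Set.Icc 0 (2 * Real.pi)) P volume
  azimuth_law : ∀ l r, P.map (azimuth l r) = μ
  elevation_law : ∀ l r, P.map (elevation l r) = ν
  phase_iIndep : iIndepFun (fun q : Fin L × (Fin C × Fin S) => phase q.1 q.2) P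
  phase_indep_angles :
    IndepFun (fun ω (q : Fin L × (Fin C × Fin S)) => phase q.1 q.2 ω)
      (fun ω (q : Fin L × (Fin C × Fin S)) => (azimuth q.1 q.2 ω, elevation q.1 q.2 ω)) P
  angles_iIndep : ∀ l l', l ≠ l' → ∀ r r',
    iIndepFun ![azimuth l r, elevation l r, azimuth l' r', elevation l' r'] P

namespace RayModel

variable {Ω : Type*} [MeasurableSpace Ω] {P : Measure Ω} {μ ν : Measure ℝ} {L C S : ℕ}

/-- The total link gain `β^{(l)}` of user `l`. -/
def gain (R : RayModel P μ ν L C S) (l : Fin L) : ℝ := ∑ r, R.power l r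

/-- The channel vector `h_l = ∑_r √β_r e^{jΘ_r} a(φ_r, θ_r)` of user `l`, for the steering vector
`a : (azimuth) → (elevation) → (antenna) → ℂ`. -/
noncomputable def channel {ι : Type*} (R : RayModel P μ ν L C S) (a : ℝ → ℝ → ι → ℂ)
    (l : Fin L) (ω : Ω) : ι → ℂ := fun m =>
  ∑ r, (Real.sqrt (R.power l r) : ℂ) * Complex.exp (Complex.I * R.phase l r ω) *
    a (R.azimuth l r ω) (R.elevation l r ω) m

/-- The interference power `|h_lᴴ h_{l'}|²`. -/
noncomputable def interference {ι : Type*} [Fintype ι] (R : RayModel P μ ν L C S)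
    (a : ℝ → ℝ → ι → ℂ) (l l' : Fin L) (ω : Ω) : ℝ :=
  ‖star (R.channel a l ω) ⬝ᵥ R.channel a l' ω‖ ^ 2

/-- The normalised mean interference `κ = E|h_lᴴ h_{l'}|² / (M² β^{(l)} β^{(l')})`, where `M` is the
number of antennas. -/
noncomputable def nmi {ι : Type*} [Fintype ι] (R : RayModel P μ ν L C S)
    (a : ℝ → ℝ → ι → ℂ) (l l' : Fin L) : ℝ :=
  (∫ ω, R.interference a l l' ω ∂P) / ((Fintype.card ι : ℝ) ^ 2 * R.gain l * R.gain l')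

end RayModel

/-- The angular position `Ψ_m = 2πm/M_r` of antenna `m` on the circle. -/
noncomputable def circAngle (Mr : ℕ) (m : Fin Mr) : ℝ := 2 * Real.pi * (m : ℕ) / Mr

/-- Steering vector of a uniform circular array. -/
noncomputable def steerCirc (Mr : ℕ) (dr φ θ : ℝ) (m : Fin Mr) : ℂ :=
  Complex.exp (Complex.I *
    (Real.pi * dr / Real.sin (Real.pi / Mr) * Real.sin θ * Real.cos (φ - circAngle Mr m) : ℝ))

/-- Steering vector of a uniform linear array along the `y`-axis (antennas numbered from `0`). -/
noncomputable def steerY (My : ℕ) (dy φ θ : ℝ) (m : Fin My) : ℂ :=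
  Complex.exp (Complex.I * (2 * Real.pi * dy * (m : ℕ) * Real.sin θ * Real.sin φ : ℝ))

/-- Steering vector of a uniform linear array along the `z`-axis (antennas numbered from `0`). -/
noncomputable def steerZ (Mz : ℕ) (dz θ : ℝ) (m : Fin Mz) : ℂ :=
  Complex.exp (Complex.I * (2 * Real.pi * dz * (m : ℕ) * Real.cos θ : ℝ))

/-- Steering vector of the uniform cylindrical array, the Kronecker product `a_r ⊗ a_z`. -/
noncomputable def steerUCylA (Mr Mz : ℕ) (dr dz φ θ : ℝ) (m : Fin Mr × Fin Mz) : ℂ :=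
  steerCirc Mr dr φ θ m.1 * steerZ Mz dz θ m.2

/-- Steering vector of the vertical uniform rectangular array, the Kronecker product
`a_y ⊗ a_z`. -/
noncomputable def steerVURA (My Mz : ℕ) (dy dz φ θ : ℝ) (m : Fin My × Fin Mz) : ℂ :=
  steerY My dy φ θ m.1 * steerZ Mz dz θ m.2

/-- `ψ(n) = E e^{jnφ}`, the characteristic function of the azimuth. -/
noncomputable def psiCF (μ : Measure ℝ) (n : ℤ) : ℂ := charFun μ (n : ℝ)

/-- `χ(n) = E e^{jn(θ - π/2)}`, the characteristic function of the elevation, relative to the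
broadside direction `θ = π/2`. -/
noncomputable def chiCF (ν : Measure ℝ) (n : ℤ) : ℂ :=
  charFun (ν.map fun θ => θ - Real.pi / 2) (n : ℝ)

/-- The summand of index `k` of the series in `G(n, n', n̂, z₂)`; here `n₁ = n'` and `n₂ = n̂`. -/
noncomputable def gTerm (n₁ n₂ : ℤ) (z₂ : ℝ) (k : ℕ+) : ℂ :=
  (-1) ^ ((k : ℤ) - n₁ - n₂) *
    (besselJ (2 * (k : ℕ) - 1) z₂ * (2 * (n₁ + n₂)) /
      ((2 * (k : ℕ) - 1) ^ 2 - 4 * (n₁ + n₂) ^ 2))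

/-- `G(n, n', n̂, z₂)` with `n₁ = n'` and `n₂ = n̂`; it does not depend on `n`. -/
noncomputable def gFun (n₁ n₂ : ℤ) (z₂ : ℝ) : ℂ :=
  besselJ (2 * (n₁ + n₂)) z₂ + 4 / Real.pi * ∑' k : ℕ+, gTerm n₁ n₂ z₂ k

/-- `J_{|n|/2-n̂}(z₁/2) J_{|n|/2+n̂}(z₁/2) G(n, n', n̂, z₂)`. For odd `n` and `z₁ = 0`, where one of
the two Bessel factors may be singular, the value is `0`, the limit of the product as `z₁ → 0`,
since `0 ^ s = 0` for `s ≠ 0`. -/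
noncomputable def vTerm (n n₁ n₂ : ℤ) (z₁ z₂ : ℝ) : ℂ :=
  besselJ (|(n : ℝ)| / 2 - n₂) (z₁ / 2) * besselJ (|(n : ℝ)| / 2 + n₂) (z₁ / 2) * gFun n₁ n₂ z₂

/-- The term of index `n'` of the middle series in `V`. -/
noncomputable def vMid (ν : Measure ℝ) (n n₁ : ℤ) (z₁ z₂ : ℝ) : ℂ :=
  chiCF ν (2 * n₁) * ∑' n₂ : ℤ, vTerm n n₁ n₂ z₁ z₂

/-- The term of index `n` of the outer series in `V`. The middle series, over `n'`, is the limit of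
the symmetric partial sums, as usual for Fourier series. -/
noncomputable def vOut (μ ν : Measure ℝ) (n : ℤ) (A z₁ z₂ : ℝ) : ℂ :=
  (-1) ^ (min n 0) * Complex.exp (Complex.I * n * A) * psiCF μ n *
    ∑'[symmetricIcc ℤ] n₁ : ℤ, vMid ν n n₁ z₁ z₂

/-- The triple series `V(A, z₁, z₂)`. -/
noncomputable def vSeries (μ ν : Measure ℝ) (A z₁ z₂ : ℝ) : ℂ := ∑' n : ℤ, vOut μ ν n A z₁ z₂

/-- All the series in the definition of `V(A, z₁, z₂)` converge. -/
def VConverges (μ ν : Measure ℝ) (A z₁ z₂ : ℝ) : Prop :=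
  (∀ n₁ n₂ : ℤ, Summable (gTerm n₁ n₂ z₂)) ∧
  (∀ n n₁ : ℤ, Summable fun n₂ : ℤ => vTerm n n₁ n₂ z₁ z₂) ∧
  (∀ n : ℤ, Summable (fun n₁ : ℤ => vMid ν n n₁ z₁ z₂) (symmetricIcc ℤ)) ∧
  Summable fun n : ℤ => vOut μ ν n A z₁ z₂

/-- `a = sin Ψ_m - sin Ψ_{m'}`. -/
noncomputable def cylS (Mr : ℕ) (m m' : Fin Mr) : ℝ :=
  Real.sin (circAngle Mr m) - Real.sin (circAngle Mr m')

/-- `b = cos Ψ_m - cos Ψ_{m'}`. -/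
noncomputable def cylC (Mr : ℕ) (m m' : Fin Mr) : ℝ :=
  Real.cos (circAngle Mr m) - Real.cos (circAngle Mr m')

/-- `arctan (b / a)`, with the value `± π/2` (the sign being that of `b`) for `a = 0 ≠ b`, and `0`
for `a = b = 0`. -/
noncomputable def arctanQuot (b a : ℝ) : ℝ :=
  if a = 0 then (SignType.sign b : ℝ) * (Real.pi / 2) else Real.arctan (b / a)

/-- The parameter `A` of the cylindrical array. -/
noncomputable def cylA (Mr : ℕ) (m m' : Fin Mr) : ℝ := arctanQuot (cylC Mr m m') (cylS Mr m m')

/-- The parameter `z₁` of the cylindrical array. -/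
noncomputable def cylZ₁ (Mr : ℕ) (dr : ℝ) (m m' : Fin Mr) : ℝ :=
  Real.sqrt (cylS Mr m m' ^ 2 + cylC Mr m m' ^ 2) * Real.pi * dr / Real.sin (Real.pi / Mr)

/-- The parameter `2πd(m - m')` of a linear array with spacing `d`. -/
noncomputable def linZ {N : ℕ} (d : ℝ) (m m' : Fin N) : ℝ :=
  2 * Real.pi * d * (((m : ℕ) : ℝ) - ((m' : ℕ) : ℝ))

/-!
Expanding the azimuth factor of the array response by the Jacobi-Anger formula separates the
integers `n`, with coefficients `J_n(z₁ cos t)`, where `t = θ - π/2` is the elevation relative to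
broadside. By Neumann's integral the products `J_{|n|/2-n̂}(z₁/2) J_{|n|/2+n̂}(z₁/2)` are the
Fourier coefficients of `J_{|n|}(z₁ cos t)` on the half turn `|t| ≤ π/2`, and `G` lists those of
the vertical factor; their convolution, the sum over `n̂`, gives the Fourier coefficients of the
product. The product takes different values at `t = ±π/2`, so its Fourier series converges only
symmetrically; but, like the sawtooth series, it does so boundedly on the open interval, and
dominated convergence identifies `V(A, z₁, z₂)` with the expectation of `e^{j(z₁ sin θ sin(φ + A) +
z₂ cos θ)}`.

The relative phase factors of pairs of rays are orthonormal and independent of the angles. Hence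
`κ` is the sum over pairs of antennas of the squared moduli of their correlations, divided by `M²`;
each correlation is such an expectation.
-/

section Bessel

open scoped Nat Real

/-- The `m`-th term of the power series of the Bessel function `J_n` of natural order. -/
noncomputable def besselTerm (n : ℕ) (z : ℂ) (m : ℕ) : ℂ :=
  (-1) ^ m / (m ! * (m + n)!) * (z / 2) ^ (2 * m + n)

theorem norm_besselTerm_le (n : ℕ) (z : ℂ) (m : ℕ) :
    ‖besselTerm n z m‖ ≤ ‖z / 2‖ ^ n / n ! * ((‖z / 2‖ ^ 2) ^ m / m !) := by
  have hnorm : ‖besselTerm n z m‖ = ‖z / 2‖ ^ n * (‖z / 2‖ ^ 2) ^ m / (m ! * (m + n)!) := by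
    simp only [besselTerm, norm_mul, norm_div, norm_pow, norm_neg, norm_one, one_pow,
      Complex.norm_natCast]
    ring
  have hfact : (n ! : ℝ) ≤ (m + n)! := mod_cast Nat.factorial_le (Nat.le_add_left n m)
  rw [hnorm, div_mul_div_comm, mul_comm (n ! : ℝ)]
  gcongr

theorem hasSum_besselTerm_bound (n : ℕ) (x : ℝ) :
    HasSum (fun m : ℕ => x ^ n / n ! * ((x ^ 2) ^ m / m !)) (x ^ n / n ! * Real.exp (x ^ 2)) := by
  rw [Real.exp_eq_exp_ℝ]
  exact (NormedSpace.expSeries_div_hasSum_exp (x ^ 2)).mul_left _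

theorem summable_besselTerm (n : ℕ) (z : ℂ) : Summable (besselTerm n z) :=
  .of_norm_bounded (hasSum_besselTerm_bound n ‖z / 2‖).summable (norm_besselTerm_le n z)

theorem besselJ_natCast (n : ℕ) (z : ℂ) : besselJ n z = ∑' m, besselTerm n z m := by
  rw [besselJ, ← tsum_mul_left]
  congr 1 with m
  have hGamma : Complex.Gamma (m + ((n : ℝ) : ℂ) + 1) = (m + n)! := by
    rw [← Complex.Gamma_nat_eq_factorial]
    push_cast
    rfl
  rw [hGamma, Complex.ofReal_natCast, Complex.cpow_natCast, besselTerm, pow_add]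
  ring

theorem hasSum_besselTerm (n : ℕ) (z : ℂ) : HasSum (besselTerm n z) (besselJ n z) :=
  besselJ_natCast n z ▸ (summable_besselTerm n z).hasSum

theorem norm_besselJ_natCast_le (n : ℕ) (z : ℂ) :
    ‖besselJ n z‖ ≤ ‖z / 2‖ ^ n / n ! * Real.exp (‖z / 2‖ ^ 2) :=
  besselJ_natCast n z ▸
    tsum_of_norm_bounded (hasSum_besselTerm_bound n ‖z / 2‖) (norm_besselTerm_le n z)

theorem differentiable_besselJ_natCast (n : ℕ) : Differentiable ℂ (besselJ n) := by
  intro z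
  simp only [funext (besselJ_natCast n)]
  have hdiff : DifferentiableOn ℂ (fun w => ∑' m, besselTerm n w m)
      (Metric.ball 0 (‖z‖ + 1)) := by
    refine Complex.differentiableOn_tsum_of_summable_norm
      (hasSum_besselTerm_bound n ((‖z‖ + 1) / 2)).summable (fun m => ?_) Metric.isOpen_ball
      fun m w hw => (norm_besselTerm_le n w m).trans ?_
    · unfold besselTerm
      fun_prop
    · have : ‖w / 2‖ ≤ (‖z‖ + 1) / 2 := by
        rw [norm_div, Complex.norm_ofNat]
        gcongr
        exact (mem_ball_zero_iff.1 hw).le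
      gcongr
  exact hdiff.differentiableAt (Metric.isOpen_ball.mem_nhds (by simp))

theorem besselJ_zero_right (ν : ℝ) : besselJ ν 0 = if ν = 0 then 1 else 0 := by
  split_ifs with hν
  · rw [besselJ, tsum_eq_single 0 fun m hm => by simp [hm]]
    simp [hν]
  · simp [besselJ, hν]

theorem besselJ_neg_natCast (n : ℕ) (z : ℂ) : besselJ (-n) z = (-1) ^ n * besselJ n z := by
  rcases eq_or_ne z 0 with rfl | hz
  · rcases eq_or_ne n 0 with rfl | hn <;> simp [besselJ_zero_right, *]
  set f : ℕ → ℂ := fun m => (-1) ^ m / (m ! * Complex.Gamma (m + ((-n : ℝ) : ℂ) + 1)) *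
    (z / 2) ^ (2 * m) with hf
  have hpole : ∀ m < n, f m = 0 := by
    intro m hm
    have : (m : ℂ) + ((-n : ℝ) : ℂ) + 1 = -((n - (m + 1) : ℕ) : ℂ) := by
      push_cast [Nat.cast_sub hm]
      ring
    simp only [hf, this, Complex.Gamma_neg_nat_eq_zero, mul_zero, div_zero, zero_mul]
  have hshift : ∑' m, f (m + n) = ∑' m, f m := by
    refine (add_left_injective n).tsum_eq fun m hm => ?_
    have : n ≤ m := not_lt.1 fun hlt => hm (hpole m hlt)
    exact ⟨m - n, Nat.sub_add_cancel this⟩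
  rw [besselJ, ← hshift, besselJ_natCast, ← tsum_mul_left, ← tsum_mul_left]
  congr 1 with m
  have hGamma : Complex.Gamma ((m + n : ℕ) + ((-n : ℝ) : ℂ) + 1) = m ! := by
    rw [← Complex.Gamma_nat_eq_factorial]
    push_cast
    ring_nf
  have hz2 : z / 2 ≠ 0 := by simpa using hz
  have hpow : (z / 2) ^ (2 * (m + n)) = (z / 2) ^ n * (z / 2) ^ (2 * m + n) := by ring
  simp only [hf, hGamma]
  rw [besselTerm, hpow, Complex.ofReal_neg, Complex.ofReal_natCast, Complex.cpow_neg,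
    Complex.cpow_natCast, pow_add (-1 : ℂ)]
  field_simp

theorem besselJ_intCast (n : ℤ) (z : ℂ) :
    besselJ n z = (-1) ^ min n 0 * besselJ n.natAbs z := by
  obtain ⟨k, rfl | rfl⟩ := n.eq_nat_or_neg
  · simp
  · rw [min_eq_left (by simp), Int.cast_neg, Int.cast_natCast, besselJ_neg_natCast,
      Int.natAbs_neg, Int.natAbs_natCast, zpow_neg, zpow_natCast, ← inv_pow, inv_neg_one]

theorem norm_besselJ_intCast (n : ℤ) (z : ℂ) : ‖besselJ n z‖ = ‖besselJ n.natAbs z‖ := by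
  simp [besselJ_intCast n]

theorem summable_besselJ_bound (x : ℝ) :
    Summable fun n : ℤ => x ^ n.natAbs / n.natAbs ! * Real.exp (x ^ 2) := by
  refine Summable.mul_right _ (.of_nat_of_neg ?_ ?_) <;>
    simpa using Real.summable_pow_div_factorial x

theorem norm_besselJ_intCast_le (n : ℤ) {z : ℂ} {x : ℝ} (hz : ‖z / 2‖ ≤ x) :
    ‖besselJ n z‖ ≤ x ^ n.natAbs / n.natAbs ! * Real.exp (x ^ 2) := by
  have hx : 0 ≤ x := (norm_nonneg _).trans hz
  rw [norm_besselJ_intCast]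
  refine (norm_besselJ_natCast_le _ _).trans ?_
  gcongr

theorem summable_norm_besselJ_intCast (z : ℂ) : Summable fun n : ℤ => ‖besselJ n z‖ :=
  (summable_besselJ_bound ‖z / 2‖).of_nonneg_of_le (fun _ => norm_nonneg _) fun n =>
    norm_besselJ_intCast_le n le_rfl

/-- A pair of natural numbers is determined by its difference and its minimum. -/
def diffMinEquiv : ℤ × ℕ ≃ ℕ × ℕ where
  toFun q := (q.2 + q.1.toNat, q.2 + (-q.1).toNat)
  invFun q := ((q.1 : ℤ) - q.2, min q.1 q.2)
  left_inv := by
    rintro ⟨n, m⟩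
    simp only [Prod.mk.injEq]
    omega
  right_inv := by
    rintro ⟨n, m⟩
    ext <;> simp <;> omega

theorem expSeries_mul_expSeries_diffMinEquiv (z : ℂ) {t : ℂ} (ht : t ≠ 0) (q : ℤ × ℕ) :
    (z / 2 * t) ^ (diffMinEquiv q).1 / (diffMinEquiv q).1 ! *
      ((-(z / 2) * t⁻¹) ^ (diffMinEquiv q).2 / (diffMinEquiv q).2 !) =
    (-1) ^ min q.1 0 * t ^ q.1 * besselTerm q.1.natAbs z q.2 := by
  obtain ⟨n, m⟩ := q
  have hfact (k : ℕ) : (k ! : ℂ) ≠ 0 := Nat.cast_ne_zero.2 k.factorial_ne_zero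
  have hm := hfact m
  obtain ⟨k, rfl | rfl⟩ := n.eq_nat_or_neg <;> have hk := hfact (m + k)
  · simp only [diffMinEquiv, Equiv.coe_fn_mk, besselTerm, Int.toNat_natCast, Int.toNat_neg_natCast,
      Int.natAbs_natCast, min_eq_right (Int.natCast_nonneg k), zpow_zero, zpow_natCast, add_zero]
    rw [mul_pow, mul_pow, neg_pow, inv_pow, pow_add t]
    field_simp
    ring
  · have hsign : ((-1 : ℂ) ^ k)⁻¹ = (-1) ^ k := by rw [← inv_pow, inv_neg_one]
    simp only [diffMinEquiv, Equiv.coe_fn_mk, besselTerm, neg_neg, Int.toNat_natCast,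
      Int.toNat_neg_natCast, Int.natAbs_neg, Int.natAbs_natCast,
      min_eq_left (neg_nonpos.2 (Int.natCast_nonneg k)), zpow_neg, zpow_natCast, add_zero, hsign]
    rw [mul_pow, mul_pow, neg_pow, inv_pow, pow_add t, pow_add (-1 : ℂ)]
    field_simp
    ring

theorem hasSum_besselJ_mul_zpow (z : ℂ) {t : ℂ} (ht : t ≠ 0) :
    HasSum (fun n : ℤ => besselJ n z * t ^ n) (Complex.exp (z / 2 * (t - t⁻¹))) := by
  have hexp (w : ℂ) : HasSum (fun n : ℕ => w ^ n / (n ! : ℂ)) (Complex.exp w) := by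
    rw [Complex.exp_eq_exp_ℂ]
    exact NormedSpace.expSeries_div_hasSum_exp w
  have hnorm (w : ℂ) : Summable fun n : ℕ => ‖w ^ n / (n ! : ℂ)‖ :=
    NormedSpace.norm_expSeries_div_summable w
  have hprod : HasSum (fun q : ℕ × ℕ => (z / 2 * t) ^ q.1 / (q.1 ! : ℂ) *
      ((-(z / 2) * t⁻¹) ^ q.2 / (q.2 ! : ℂ))) (Complex.exp (z / 2 * (t - t⁻¹))) := by
    have hsum := summable_mul_of_summable_norm (hnorm (z / 2 * t)) (hnorm (-(z / 2) * t⁻¹))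
    rw [show z / 2 * (t - t⁻¹) = z / 2 * t + -(z / 2) * t⁻¹ by ring, Complex.exp_add]
    rw [← (hexp (z / 2 * t)).tsum_eq, ← (hexp (-(z / 2) * t⁻¹)).tsum_eq,
      tsum_mul_tsum_of_summable_norm (hnorm (z / 2 * t)) (hnorm (-(z / 2) * t⁻¹))]
    exact hsum.hasSum
  rw [← diffMinEquiv.hasSum_iff] at hprod
  simp only [Function.comp_def, expSeries_mul_expSeries_diffMinEquiv z ht] at hprod
  refine hprod.prod_fiberwise fun n => ?_
  simp only [besselJ_intCast n, mul_right_comm _ _ (t ^ n)]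
  exact (hasSum_besselTerm n.natAbs z).mul_left ((-1) ^ min n 0 * t ^ n)

theorem hasSum_besselJ_exp_sin (z s : ℂ) :
    HasSum (fun n : ℤ => besselJ n z * Complex.exp (Complex.I * n * s))
      (Complex.exp (Complex.I * (z * Complex.sin s))) := by
  convert hasSum_besselJ_mul_zpow z (Complex.exp_ne_zero (Complex.I * s)) using 1
  · ext n
    rw [← Complex.exp_int_mul]
    ring_nf
  · rw [← Complex.exp_neg, Complex.sin]
    congr 1
    rw [mul_comm s, neg_mul, mul_comm s]
    linear_combination (-z / 2 * (Complex.exp (Complex.I * s) -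
      Complex.exp (-(Complex.I * s)))) * Complex.I_sq

end Bessel

section Neumann

open Complex (I)
open Finset.HasAntidiagonal (antidiagonal mem_antidiagonal)
open scoped Nat Real

theorem sum_choose_mul_inv_Gamma (m : ℕ) {n : ℕ} {a b : ℂ} (hab : a + b = n) :
    ∑ q ∈ antidiagonal m, (m.choose q.1 : ℂ) *
      ((Complex.Gamma (q.1 + a + 1))⁻¹ * (Complex.Gamma (q.2 + b + 1))⁻¹) =
    (n + 2 * m)! / (n + m)! *
      ((Complex.Gamma (m + a + 1))⁻¹ * (Complex.Gamma (m + b + 1))⁻¹) := by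
  induction m generalizing n a b with
  | zero => simp [div_self (Nat.cast_ne_zero.2 n.factorial_ne_zero : (n ! : ℂ) ≠ 0)]
  | succ m ih =>
    have ha := Complex.one_div_Gamma_eq_self_mul_one_div_Gamma_add_one (m + a + 1)
    have hb := Complex.one_div_Gamma_eq_self_mul_one_div_Gamma_add_one (m + b + 1)
    have ihb := ih (n := n + 1) (a := a) (b := b + 1) (by push_cast; linear_combination hab)
    have iha := ih (n := n + 1) (a := a + 1) (b := b) (by push_cast; linear_combination hab)
    have hsymm : ∀ q ∈ antidiagonal m, (m.choose q.2 : ℂ) = m.choose q.1 := fun q hq => by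
      rw [Nat.choose_symm_of_eq_add (mem_antidiagonal.1 hq).symm]
    rw [Finset.sum_antidiagonal_choose_succ_mul
      (fun i j : ℕ => (Complex.Gamma (i + a + 1))⁻¹ * (Complex.Gamma (j + b + 1))⁻¹)]
    simp only [Nat.cast_add_one, add_right_comm _ (1 : ℂ) a, add_right_comm _ (1 : ℂ) b,
      ← add_assoc] at iha ihb ⊢
    rw [ihb, Finset.sum_congr rfl fun q hq => by rw [hsymm q hq], iha, ha, hb,
      show n + 2 * (m + 1) = (n + 1 + 2 * m) + 1 by ring, add_right_comm n m 1,
      Nat.factorial_succ (n + 1 + 2 * m)]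
    push_cast
    linear_combination ((n + 1 + 2 * m)! : ℂ) / ((n + 1 + m)! : ℂ) *
      ((Complex.Gamma (m + a + 1 + 1))⁻¹ * (Complex.Gamma (m + b + 1 + 1))⁻¹) * hab

theorem integral_exp_half_period (q : ℂ) :
    ∫ t in -(π / 2)..π / 2, Complex.exp (I * q * t) =
      π * ((Complex.Gamma (q / 2 + 1))⁻¹ * (Complex.Gamma (-q / 2 + 1))⁻¹) := by
  rcases eq_or_ne q 0 with rfl | hq
  · simp
  have hpi : (π : ℂ) ≠ 0 := Complex.ofReal_ne_zero.2 Real.pi_ne_zero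
  have hreflect : (Complex.Gamma (q / 2 + 1))⁻¹ * (Complex.Gamma (-q / 2 + 1))⁻¹ =
      Complex.sin (π * (q / 2)) / π / (q / 2) := by
    have h := Complex.one_div_Gamma_eq_self_mul_one_div_Gamma_add_one (q / 2)
    rw [show -q / 2 + 1 = 1 - q / 2 by ring, eq_div_iff (by simpa using hq),
      ← inv_div (π : ℂ), ← Complex.Gamma_mul_Gamma_one_sub, mul_inv, h]
    ring
  have hsin : Complex.exp (I * q * (π / 2 : ℝ)) - Complex.exp (I * q * (-(π / 2) : ℝ)) =
      2 * I * Complex.sin (π * (q / 2)) := by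
    rw [Complex.sin, show I * q * (π / 2 : ℝ) = π * (q / 2) * I by push_cast; ring,
      show I * q * (-(π / 2) : ℝ) = -(π * (q / 2)) * I by push_cast; ring]
    linear_combination (Complex.exp (π * (q / 2) * I) - Complex.exp (-(π * (q / 2)) * I)) *
      Complex.I_sq
  rw [integral_exp_mul_complex (mul_ne_zero Complex.I_ne_zero hq), hsin, hreflect]
  have := Complex.I_ne_zero
  field_simp

/-- Cauchy's beta integral. -/
theorem integral_cos_pow_mul_exp (p : ℕ) (q : ℂ) :
    ∫ t in -(π / 2)..π / 2, (Real.cos t : ℂ) ^ p * Complex.exp (I * q * t) =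
      π * (p ! / 2 ^ p *
        ((Complex.Gamma ((p + q) / 2 + 1))⁻¹ * (Complex.Gamma ((p - q) / 2 + 1))⁻¹)) := by
  induction p generalizing q with
  | zero => simpa using integral_exp_half_period q
  | succ p ih =>
    have hstep (t : ℝ) : (Real.cos t : ℂ) ^ (p + 1) * Complex.exp (I * q * t) =
        1 / 2 * ((Real.cos t : ℂ) ^ p * Complex.exp (I * (q + 1) * t) +
          (Real.cos t : ℂ) ^ p * Complex.exp (I * (q - 1) * t)) := by
      rw [show I * (q + 1) * t = I * q * t + t * I by ring,
        show I * (q - 1) * t = I * q * t + -t * I by ring, Complex.exp_add, Complex.exp_add,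
        pow_succ, mul_assoc, Complex.ofReal_cos, Complex.cos]
      ring
    have hint (r : ℂ) : IntervalIntegrable
        (fun t : ℝ => (Real.cos t : ℂ) ^ p * Complex.exp (I * r * t)) volume (-(π / 2)) (π / 2) :=
      Continuous.intervalIntegrable (by fun_prop) _ _
    simp only [hstep]
    rw [intervalIntegral.integral_const_mul, intervalIntegral.integral_add (hint _) (hint _),
      ih, ih]
    have hadd := Complex.one_div_Gamma_eq_self_mul_one_div_Gamma_add_one ((p + q + 1) / 2)
    have hsub := Complex.one_div_Gamma_eq_self_mul_one_div_Gamma_add_one ((p - q + 1) / 2)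
    push_cast
    rw [show (p + (q + 1)) / 2 + 1 = (p + q + 1) / 2 + 1 by ring,
      show (p - (q + 1)) / 2 + 1 = (p - q + 1) / 2 by ring,
      show (p + (q - 1)) / 2 + 1 = (p + q + 1) / 2 by ring,
      show (p - (q - 1)) / 2 + 1 = (p - q + 1) / 2 + 1 by ring,
      show (p + 1 + q) / 2 + 1 = (p + q + 1) / 2 + 1 by ring,
      show (p + 1 - q) / 2 + 1 = (p - q + 1) / 2 + 1 by ring, hadd, hsub,
      Nat.factorial_succ, pow_succ]
    push_cast
    ring

/-- The `m`-th term of the power series of the entire function `(z/2)^{-ν} J_ν(z)`. -/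
noncomputable def besselSeriesTerm (ν : ℝ) (z : ℂ) (m : ℕ) : ℂ :=
  (-1) ^ m / (m ! * Complex.Gamma (m + ν + 1)) * (z / 2) ^ (2 * m)

theorem besselSeriesTerm_succ {ν : ℝ} {m : ℕ} (h : (m : ℂ) + ν + 1 ≠ 0) (z : ℂ) :
    besselSeriesTerm ν z (m + 1) =
      -((z / 2) ^ 2 / ((m + 1) * (m + ν + 1))) * besselSeriesTerm ν z m := by
  have hGamma : Complex.Gamma ((m + 1 : ℕ) + ν + 1) = (m + ν + 1) * Complex.Gamma (m + ν + 1) := by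
    rw [← Complex.Gamma_add_one _ h]
    push_cast
    ring_nf
  rw [besselSeriesTerm, besselSeriesTerm, hGamma, Nat.factorial_succ, pow_succ, mul_add, pow_add]
  simp only [div_eq_mul_inv, mul_inv, Nat.cast_mul, Nat.cast_add_one]
  ring

theorem summable_norm_besselSeriesTerm (ν : ℝ) (z : ℂ) :
    Summable fun m => ‖besselSeriesTerm ν z m‖ := by
  obtain ⟨N, hN⟩ := exists_nat_ge (max (-ν) (2 * ‖z / 2‖ ^ 2))
  refine summable_of_ratio_norm_eventually_le (r := 1 / 2) (by norm_num) ?_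
  filter_upwards [Filter.eventually_ge_atTop N] with m hm
  have hNm : (N : ℝ) ≤ m := mod_cast hm
  have hν : 1 ≤ m + ν + 1 := by linarith [(le_max_left _ _).trans (hN.trans hNm)]
  have hz : 2 * ‖z / 2‖ ^ 2 ≤ m := (le_max_right _ _).trans (hN.trans hNm)
  have hcast : (m : ℂ) + ν + 1 = (m + ν + 1 : ℝ) := by push_cast; rfl
  have hne : (m : ℂ) + ν + 1 ≠ 0 := by
    rw [hcast, Complex.ofReal_ne_zero]
    linarith
  rw [norm_norm, norm_norm, besselSeriesTerm_succ hne, norm_mul]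
  gcongr
  rw [norm_neg, norm_div, norm_mul, hcast, Complex.norm_of_nonneg (by linarith), ← Nat.cast_add_one,
    Complex.norm_natCast, norm_pow, div_le_iff₀ (by positivity)]
  push_cast
  nlinarith

theorem sum_antidiagonal_besselSeriesTerm {n : ℕ} {a b : ℝ} (hab : a + b = n) (z : ℂ) (m : ℕ) :
    ∑ q ∈ antidiagonal m, besselSeriesTerm a z q.1 * besselSeriesTerm b z q.2 =
      (-1) ^ m * (z / 2) ^ (2 * m) / m ! * ((n + 2 * m)! / (n + m)! *
        ((Complex.Gamma (m + a + 1))⁻¹ * (Complex.Gamma (m + b + 1))⁻¹)) := by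
  rw [← sum_choose_mul_inv_Gamma m (by exact_mod_cast hab), Finset.mul_sum]
  refine Finset.sum_congr rfl fun ⟨i, j⟩ hq => ?_
  obtain rfl := mem_antidiagonal.1 hq
  have hfact (k : ℕ) : (k ! : ℂ) ≠ 0 := Nat.cast_ne_zero.2 k.factorial_ne_zero
  have hchoose : ((i + j).choose i : ℂ) / (i + j)! = (i ! : ℂ)⁻¹ * (j ! : ℂ)⁻¹ := by
    rw [Nat.cast_add_choose]
    field_simp [hfact]
  calc besselSeriesTerm a z i * besselSeriesTerm b z j
      = (-1) ^ (i + j) * (z / 2) ^ (2 * (i + j)) * ((i ! : ℂ)⁻¹ * (j ! : ℂ)⁻¹) *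
        ((Complex.Gamma (i + a + 1))⁻¹ * (Complex.Gamma (j + b + 1))⁻¹) := by
        rw [besselSeriesTerm, besselSeriesTerm, pow_add, mul_add, pow_add]
        simp only [div_eq_mul_inv, mul_inv]
        ring
    _ = _ := by
        rw [← hchoose]
        ring

theorem hasSum_integral_besselTerm_mul (n : ℕ) (z : ℂ) {f : ℝ → ℂ} {a b : ℝ}
    (hf : IntervalIntegrable f volume a b) :
    HasSum (fun m => ∫ t in a..b, besselTerm n (z * Real.cos t) m * f t)
      (∫ t in a..b, besselJ n (z * Real.cos t) * f t) := by
  have hbound := hasSum_besselTerm_bound n ‖z / 2‖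
  refine intervalIntegral.hasSum_integral_of_dominated_convergence
    (fun m t => ‖z / 2‖ ^ n / n ! * ((‖z / 2‖ ^ 2) ^ m / m !) * ‖f t‖)
    (fun m => ?_) (fun m => .of_forall fun t _ => ?_)
    (.of_forall fun t _ => hbound.summable.mul_right _) ?_
    (.of_forall fun t _ => (hasSum_besselTerm n _).mul_right _)
  · have hcont : Continuous fun t : ℝ => besselTerm n (z * Real.cos t) m := by
      unfold besselTerm
      fun_prop
    exact hcont.aestronglyMeasurable.mul hf.def'.aestronglyMeasurable
  · have hcos : ‖z * Real.cos t / 2‖ ≤ ‖z / 2‖ := by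
      rw [mul_div_right_comm, norm_mul, Complex.norm_real, Real.norm_eq_abs]
      exact mul_le_of_le_one_right (norm_nonneg _) (Real.abs_cos_le_one t)
    rw [norm_mul]
    gcongr
    refine (norm_besselTerm_le _ _ _).trans ?_
    gcongr
  · simp only [tsum_mul_right]
    exact hf.norm.const_mul _

theorem integral_besselTerm_mul_exp {n : ℕ} {a b : ℝ} (hab : a + b = n) (z : ℂ) (m : ℕ) :
    ∫ t in -(π / 2)..π / 2, besselTerm n (2 * z * Real.cos t) m * Complex.exp (I * (b - a) * t) =
      π * ((z / 2) ^ n * ((-1) ^ m * (z / 2) ^ (2 * m) / m ! * ((n + 2 * m)! / (n + m)! *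
        ((Complex.Gamma (m + a + 1))⁻¹ * (Complex.Gamma (m + b + 1))⁻¹)))) := by
  have hsplit (t : ℝ) : besselTerm n (2 * z * Real.cos t) m * Complex.exp (I * (b - a) * t) =
      (-1) ^ m / (m ! * (m + n)!) * z ^ (2 * m + n) *
        ((Real.cos t : ℂ) ^ (2 * m + n) * Complex.exp (I * (b - a) * t)) := by
    rw [besselTerm, mul_div_right_comm, mul_div_cancel_left₀ z two_ne_zero, mul_pow]
    ring
  have habC : (a : ℂ) + b = n := mod_cast hab
  simp only [hsplit, intervalIntegral.integral_const_mul, integral_cos_pow_mul_exp]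
  rw [show (((2 * m + n : ℕ) : ℂ) + (b - a)) / 2 + 1 = m + b + 1 by
      push_cast; linear_combination -habC / 2,
    show (((2 * m + n : ℕ) : ℂ) - (b - a)) / 2 + 1 = m + a + 1 by
      push_cast; linear_combination -habC / 2,
    add_comm n, add_comm n m, div_pow, div_pow, pow_add, pow_add]
  field_simp

/-- Neumann's integral. -/
theorem besselJ_mul_besselJ {n : ℕ} {a b : ℝ} (hab : a + b = n) {z : ℂ} (hz : z ≠ 0) :
    besselJ a z * besselJ b z = 1 / π * ∫ t in -(π / 2)..π / 2,
      besselJ n (2 * z * Real.cos t) * Complex.exp (I * (b - a) * t) := by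
  have hpi : (π : ℂ) ≠ 0 := Complex.ofReal_ne_zero.2 Real.pi_ne_zero
  have hexp : IntervalIntegrable (fun t : ℝ => Complex.exp (I * (b - a) * t)) volume
      (-(π / 2)) (π / 2) := Continuous.intervalIntegrable (by fun_prop) _ _
  have hseries : (∑' m, besselSeriesTerm a z m) * ∑' m, besselSeriesTerm b z m =
      ∑' m, ∑ q ∈ antidiagonal m, besselSeriesTerm a z q.1 * besselSeriesTerm b z q.2 :=
    tsum_mul_tsum_eq_tsum_sum_antidiagonal_of_summable_norm
      (summable_norm_besselSeriesTerm a z) (summable_norm_besselSeriesTerm b z)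
  calc besselJ a z * besselJ b z
      = (z / 2) ^ (n : ℂ) *
        ((∑' m, besselSeriesTerm a z m) * ∑' m, besselSeriesTerm b z m) := by
        rw [besselJ, besselJ, mul_mul_mul_comm, ← Complex.cpow_add _ _ (by simpa using hz),
          ← Complex.ofReal_add, hab, Complex.ofReal_natCast]
        rfl
    _ = 1 / π * ∑' m, π * ((z / 2) ^ n * ((-1) ^ m * (z / 2) ^ (2 * m) / m ! *
        ((n + 2 * m)! / (n + m)! *
          ((Complex.Gamma (m + a + 1))⁻¹ * (Complex.Gamma (m + b + 1))⁻¹)))) := by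
        simp only [hseries, sum_antidiagonal_besselSeriesTerm hab, tsum_mul_left,
          Complex.cpow_natCast]
        field_simp
    _ = _ := by
        rw [← (hasSum_integral_besselTerm_mul n (2 * z) hexp).tsum_eq]
        simp only [integral_besselTerm_mul_exp hab]

theorem besselJ_sub_mul_besselJ_add (n : ℕ) (k : ℤ) (z : ℂ) :
    besselJ (n / 2 - k) z * besselJ (n / 2 + k) z = 1 / π * ∫ t in -(π / 2)..π / 2,
      besselJ n (2 * z * Real.cos t) * Complex.exp (2 * I * k * t) := by
  rcases ne_or_eq z 0 with hz | rfl
  · rw [besselJ_mul_besselJ (by ring) hz]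
    push_cast
    ring_nf
  rcases eq_or_ne k 0 with rfl | hk
  · rcases eq_or_ne n 0 with rfl | hn
    · simp [besselJ_zero_right, Complex.ofReal_ne_zero.2 Real.pi_ne_zero]
    · simp [besselJ_zero_right, hn]
  · have hsum : (n : ℝ) / 2 - k ≠ 0 ∨ (n : ℝ) / 2 + k ≠ 0 := by
      by_contra! h
      exact hk (by exact_mod_cast (by linarith : (k : ℝ) = 0))
    have hexp : ∫ t in -(π / 2)..π / 2, Complex.exp (2 * I * k * t) = 0 := by
      rw [integral_exp_mul_complex (by simpa using hk),
        show 2 * I * k * (π / 2 : ℝ) = 2 * I * k * (-(π / 2) : ℝ) + k * (2 * π * I) by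
          push_cast; ring, Complex.exp_periodic.int_mul k _, sub_self, zero_div]
    have hprod : besselJ (n / 2 - k) 0 * besselJ (n / 2 + k) 0 = 0 := by
      rcases hsum with h | h <;> simp [besselJ_zero_right, h]
    rw [hprod]
    rcases eq_or_ne n 0 with rfl | hn
    · simp [besselJ_zero_right, hexp]
    · simp [besselJ_zero_right, hn]

end Neumann

section Sawtooth

open Filter Set
open scoped Real Topology

/-- The partial sums of the sawtooth series `∑ sin (k x) / k`, which converges to `(π - x) / 2`
on `(0, 2π)`. -/
noncomputable def sawSum (N : ℕ) (x : ℝ) : ℝ :=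
  ∑ k ∈ Finset.range N, Real.sin ((k + 1 : ℕ) * x) / (k + 1 : ℕ)

theorem sawSum_two_pi_sub (N : ℕ) (x : ℝ) : sawSum N (2 * π - x) = -sawSum N x := by
  unfold sawSum
  rw [← Finset.sum_neg_distrib]
  refine Finset.sum_congr rfl fun k _ => ?_
  rw [mul_sub, mul_left_comm, ← mul_assoc, mul_comm 2, mul_assoc, Real.sin_nat_mul_two_pi_sub]
  ring

theorem sawSum_pi (N : ℕ) : sawSum N π = 0 :=
  Finset.sum_eq_zero fun k _ => by rw [Real.sin_nat_mul_pi, zero_div]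

theorem hasDerivAt_sawSum (N : ℕ) (x : ℝ) :
    HasDerivAt (sawSum N) (∑ k ∈ Finset.range N, Real.cos ((k + 1 : ℕ) * x)) x := by
  unfold sawSum
  refine HasDerivAt.fun_sum fun k _ => ?_
  have h := (((hasDerivAt_id' x).const_mul ((k + 1 : ℕ) : ℝ)).sin).div_const ((k + 1 : ℕ) : ℝ)
  refine h.congr_deriv ?_
  field_simp

theorem sin_half_mul_dirichletKernel (N : ℕ) (x : ℝ) :
    Real.sin (x / 2) * (1 / 2 + ∑ k ∈ Finset.range N, Real.cos ((k + 1 : ℕ) * x)) =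
      Real.sin ((N + 1 / 2) * x) / 2 := by
  induction N with
  | zero => simp; ring_nf
  | succ N ih =>
    have h₁ : ((N : ℝ) + 1 / 2) * x = (N + 1 : ℕ) * x - x / 2 := by push_cast; ring
    have h₂ : (((N + 1 : ℕ) : ℝ) + 1 / 2) * x = (N + 1 : ℕ) * x + x / 2 := by push_cast; ring
    rw [Finset.sum_range_succ, ← add_assoc, mul_add, ih, h₁, h₂, Real.sin_sub, Real.sin_add]
    ring

/-- The envelope of the oscillating error term of `sawSum N`. -/
noncomputable def sawEnvelope (N : ℕ) (x : ℝ) : ℝ := ((2 * N + 1) * Real.sin (x / 2))⁻¹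

theorem hasDerivAt_sawEnvelope (N : ℕ) {x : ℝ} (hx : Real.sin (x / 2) ≠ 0) :
    HasDerivAt (sawEnvelope N)
      (-(Real.cos (x / 2) / (2 * (2 * N + 1) * Real.sin (x / 2) ^ 2))) x := by
  have hN : (2 * N + 1 : ℝ) ≠ 0 := by positivity
  have h := ((((hasDerivAt_id' x).div_const 2).sin.const_mul (2 * N + 1 : ℝ)).fun_inv
    (mul_ne_zero hN hx))
  refine h.congr_deriv ?_
  field_simp

-- Integrating by parts the Dirichlet kernel, the derivative of `sawSum N`, leaves an error whose
-- derivative is dominated by that of the envelope.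
theorem hasDerivAt_sawSum_error (N : ℕ) {x : ℝ} (hx : Real.sin (x / 2) ≠ 0) :
    HasDerivAt
      (fun y => sawSum N y - (π - y) / 2 + Real.cos ((N + 1 / 2) * y) * sawEnvelope N y)
      (Real.cos ((N + 1 / 2) * x) *
        -(Real.cos (x / 2) / (2 * (2 * N + 1) * Real.sin (x / 2) ^ 2))) x := by
  have hN : (2 * N + 1 : ℝ) ≠ 0 := by positivity
  have hlin := (hasDerivAt_sawSum N x).sub (((hasDerivAt_id' x).const_sub π).div_const 2)
  have hosc := ((hasDerivAt_id' x).const_mul (N + 1 / 2 : ℝ)).cos.mul (hasDerivAt_sawEnvelope N hx)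
  refine (hlin.add hosc).congr_deriv ?_
  have hkernel : Real.sin ((N + 1 / 2) * x) = 2 * Real.sin (x / 2) *
      (1 / 2 + ∑ k ∈ Finset.range N, Real.cos ((k + 1 : ℕ) * x)) := by
    linear_combination -2 * sin_half_mul_dirichletKernel N x
  rw [hkernel, sawEnvelope]
  generalize ∑ k ∈ Finset.range N, Real.cos ((k + 1 : ℕ) * x) = c
  field_simp
  ring

theorem abs_sawSum_error_le (N : ℕ) {x : ℝ} (hx : x ∈ Ico π (2 * π)) :
    |sawSum N x - (π - x) / 2 + Real.cos ((N + 1 / 2) * x) * sawEnvelope N x| ≤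
      sawEnvelope N x := by
  have hsin : ∀ y ∈ Icc π x, 0 < Real.sin (y / 2) := fun y hy =>
    Real.sin_pos_of_pos_of_lt_pi (by linarith [hy.1, Real.pi_pos]) (by linarith [hy.2, hx.2])
  have hcos : ∀ y ∈ Icc π x, Real.cos (y / 2) ≤ 0 := fun y hy =>
    Real.cos_nonpos_of_pi_div_two_le_of_le (by linarith [hy.1])
      (by linarith [hy.2, hx.2, Real.pi_pos])
  refine image_norm_le_of_norm_deriv_right_le_deriv_boundary'
    (fun y hy => (hasDerivAt_sawSum_error N (hsin y hy).ne').continuousAt.continuousWithinAt)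
    (fun y hy => (hasDerivAt_sawSum_error N
      (hsin y (Ico_subset_Icc_self hy)).ne').hasDerivWithinAt) ?_
    (fun y hy => (hasDerivAt_sawEnvelope N (hsin y hy).ne').continuousAt.continuousWithinAt)
    (fun y hy => (hasDerivAt_sawEnvelope N
      (hsin y (Ico_subset_Icc_self hy)).ne').hasDerivWithinAt)
    (fun y hy => ?_) (right_mem_Icc.2 hx.1)
  · have hcos_pi : Real.cos ((N + 1 / 2) * π) = 0 := by
      rw [add_mul, Real.cos_add, Real.sin_nat_mul_pi, one_div_mul_eq_div, Real.cos_pi_div_two]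
      ring
    rw [sawSum_pi, hcos_pi, sawEnvelope, Real.sin_pi_div_two]
    norm_num
    positivity
  · have hy' := Ico_subset_Icc_self hy
    have hnonneg : 0 ≤ -(Real.cos (y / 2) / (2 * (2 * N + 1) * Real.sin (y / 2) ^ 2)) :=
      neg_nonneg.2 (div_nonpos_of_nonpos_of_nonneg (hcos y hy') (by positivity))
    rw [norm_mul, Real.norm_of_nonneg hnonneg]
    exact mul_le_of_le_one_left hnonneg (Real.abs_cos_le_one _)

theorem abs_sawSum_sub_le (N : ℕ) {x : ℝ} (hx : x ∈ Ioo 0 (2 * π)) :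
    |sawSum N x - (π - x) / 2| ≤ 2 * sawEnvelope N x := by
  wlog hpi : π ≤ x generalizing x
  · have h := this (x := 2 * π - x) ⟨by linarith [hx.2], by linarith [hx.1]⟩ (by linarith)
    have henvelope : sawEnvelope N (2 * π - x) = sawEnvelope N x := by
      rw [sawEnvelope, sawEnvelope, ← Real.sin_pi_sub (x / 2)]; ring_nf
    rw [sawSum_two_pi_sub, henvelope, ← abs_neg] at h
    convert h using 2
    ring
  have herror := abs_sawSum_error_le N ⟨hpi, hx.2⟩
  have hpos : 0 ≤ sawEnvelope N x := (abs_nonneg _).trans herror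
  have hcos : |Real.cos ((N + 1 / 2) * x) * sawEnvelope N x| ≤ sawEnvelope N x := by
    rw [abs_mul, abs_of_nonneg hpos]
    exact mul_le_of_le_one_left hpos (Real.abs_cos_le_one _)
  rw [abs_le] at *
  constructor <;> linarith

theorem tendsto_sawSum {x : ℝ} (hx : x ∈ Ioo 0 (2 * π)) :
    Tendsto (fun N => sawSum N x) atTop (𝓝 ((π - x) / 2)) := by
  have hsin : 0 < Real.sin (x / 2) :=
    Real.sin_pos_of_pos_of_lt_pi (by linarith [hx.1]) (by linarith [hx.2])
  have hlim : Tendsto (fun N : ℕ => 2 * sawEnvelope N x) atTop (𝓝 (2 * 0)) :=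
    ((tendsto_atTop_add_const_right _ 1 (tendsto_natCast_atTop_atTop.const_mul_atTop
      two_pos)).atTop_mul_const hsin).inv_tendsto_atTop.const_mul 2
  rw [mul_zero] at hlim
  exact tendsto_iff_norm_sub_tendsto_zero.2
    (squeeze_zero (fun _ => norm_nonneg _) (fun N => abs_sawSum_sub_le N hx) hlim)

theorem abs_sawSum_le_mul (N : ℕ) {x : ℝ} (hx : 0 ≤ x) : |sawSum N x| ≤ N * x := by
  have hterm : ∀ k ∈ Finset.range N, |Real.sin ((k + 1 : ℕ) * x) / (k + 1 : ℕ)| ≤ x := by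
    intro k _
    have hk : (0 : ℝ) < (k + 1 : ℕ) := by positivity
    rw [abs_div, abs_of_pos hk, div_le_iff₀' hk]
    exact Real.abs_sin_le_abs.trans_eq (abs_of_nonneg (by positivity))
  simpa [sawSum] using (Finset.abs_sum_le_sum_abs _ _).trans (Finset.sum_le_sum hterm)

-- Gibbs' phenomenon: the partial sums overshoot near `0`, but by a bounded amount. There the crude
-- bound `N * x` takes over from the envelope.
theorem abs_sawSum_le (N : ℕ) {x : ℝ} (hx : x ∈ Ioo 0 (2 * π)) : |sawSum N x| ≤ 2 * π := by
  wlog hpi : x ≤ π generalizing x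
  · have h := this (x := 2 * π - x) ⟨by linarith [hx.2], by linarith [hx.1]⟩ (by linarith)
    rwa [sawSum_two_pi_sub, abs_neg] at h
  rcases le_or_gt ((N : ℝ) * x) 1 with hNx | hNx
  · exact (abs_sawSum_le_mul N hx.1.le).trans (by linarith [Real.pi_gt_three])
  have hsin : x ≤ π * Real.sin (x / 2) := by
    have h := Real.mul_le_sin (x := x / 2) (by linarith [hx.1]) (by linarith)
    rwa [div_mul_div_cancel₀' two_ne_zero, div_le_iff₀' Real.pi_pos] at h
  have hsin_pos : 0 < Real.sin (x / 2) := pos_of_mul_pos_right (hx.1.trans_le hsin) Real.pi_pos.le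
  have henvelope : 2 * sawEnvelope N x ≤ π := by
    rw [sawEnvelope, ← div_eq_mul_inv, div_le_iff₀ (by positivity)]
    nlinarith [hx.1, N.cast_nonneg (α := ℝ)]
  have hdist := abs_le.1 ((abs_sawSum_sub_le N hx).trans henvelope)
  rw [abs_le]
  constructor <;> linarith [hx.1]

end Sawtooth

section Fourier

open Complex (I)
open Filter Set
open scoped Interval Real Topology

variable {a b : ℝ} (hab : a < b)

theorem norm_fourier_coe_apply (T : ℝ) (k : ℤ) (t : ℝ) : ‖fourier k (t : AddCircle T)‖ = 1 := by
  rw [fourier_apply, Circle.norm_coe]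

theorem continuous_fourier_coe (T : ℝ) (k : ℤ) :
    Continuous fun t : ℝ => fourier k (t : AddCircle T) :=
  (fourier k).continuous.comp (AddCircle.continuous_mk' T)

theorem fourierCoeffOn_add {F G : ℝ → ℂ} (hF : IntervalIntegrable F volume a b)
    (hG : IntervalIntegrable G volume a b) (k : ℤ) :
    fourierCoeffOn hab (fun t => F t + G t) k =
      fourierCoeffOn hab F k + fourierCoeffOn hab G k := by
  have hcont := (continuous_fourier_coe (b - a) (-k)).continuousOn (s := [[a, b]])
  simp only [fourierCoeffOn_eq_integral, smul_add]
  rw [intervalIntegral.integral_add (hF.continuousOn_smul hcont) (hG.continuousOn_smul hcont),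
    smul_add]

theorem norm_fourierCoeffOn_le {F : ℝ → ℂ} {C : ℝ} (hC : ∀ t ∈ Ioc a b, ‖F t‖ ≤ C) (k : ℤ) :
    ‖fourierCoeffOn hab F k‖ ≤ C := by
  have hlen : 0 < b - a := sub_pos.2 hab
  have hint : ‖∫ t in a..b, fourier (-k) (t : AddCircle (b - a)) • F t‖ ≤ C * (b - a) := by
    rw [← abs_of_pos hlen]
    refine intervalIntegral.norm_integral_le_of_norm_le_const fun t ht => ?_
    rw [uIoc_of_le hab.le] at ht
    rw [norm_smul, norm_fourier_coe_apply, one_mul]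
    exact hC t ht
  rwa [fourierCoeffOn_eq_integral, norm_smul, Real.norm_of_nonneg (by positivity), one_div,
    inv_mul_le_iff₀' hlen]

theorem exists_norm_fourierCoeffOn_le {F : ℝ → ℂ} (hF : ContinuousOn F (Icc a b)) :
    ∃ C, ∀ k, ‖fourierCoeffOn hab F k‖ ≤ C := by
  obtain ⟨C, hC⟩ := isCompact_Icc.exists_bound_of_continuousOn hF
  exact ⟨C, norm_fourierCoeffOn_le hab fun t ht => hC t (Ioc_subset_Icc_self ht)⟩

theorem exists_norm_fourierCoeffOn_le_div {F : ℝ → ℂ} (hF : ContDiff ℝ 1 F) :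
    ∃ C, ∀ k : ℤ, k ≠ 0 → ‖fourierCoeffOn hab F k‖ ≤ C / |(k : ℝ)| := by
  obtain ⟨C, hC⟩ := exists_norm_fourierCoeffOn_le hab (hF.continuous_deriv le_rfl).continuousOn
  have hlen : 0 < b - a := sub_pos.2 hab
  refine ⟨(‖F b - F a‖ + (b - a) * C) / (2 * π), fun k hk => ?_⟩
  rw [fourierCoeffOn_of_hasDerivAt hab hk
    (fun x _ => (hF.differentiable one_ne_zero x).hasDerivAt)
    ((hF.continuous_deriv le_rfl).intervalIntegrable a b), norm_mul, div_div, mul_comm]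
  have hk' : ‖1 / (-2 * π * I * k)‖ = (2 * π * |(k : ℝ)|)⁻¹ := by
    simp [abs_of_pos Real.pi_pos]
  rw [hk', ← div_eq_mul_inv]
  gcongr
  refine (norm_sub_le _ _).trans (add_le_add ?_ ?_)
  · rw [norm_mul, norm_fourier_coe_apply, one_mul]
  · rw [norm_mul, ← Complex.ofReal_sub, Complex.norm_of_nonneg hlen.le]
    exact mul_le_mul_of_nonneg_left (hC k) hlen.le

theorem summable_norm_fourierCoeffOn {F : ℝ → ℂ} (hF : ContDiff ℝ 2 F) (hper : F a = F b) :
    Summable fun k => ‖fourierCoeffOn hab F k‖ := by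
  have hderiv : ContDiff ℝ 1 (deriv F) := (contDiff_succ_iff_deriv.1 hF).2.2
  have hlen : 0 < b - a := sub_pos.2 hab
  obtain ⟨C, hC⟩ := exists_norm_fourierCoeffOn_le_div hab hderiv
  have hsummable : Summable fun k : ℤ => (b - a) * C / (2 * π) * (1 / (k : ℝ) ^ 2) :=
    (Real.summable_one_div_int_pow.2 one_lt_two).mul_left _
  refine hsummable.of_norm_bounded_eventually ?_
  filter_upwards [(finite_singleton (0 : ℤ)).compl_mem_cofinite] with k (hk : k ≠ 0)
  rw [norm_norm, fourierCoeffOn_of_hasDerivAt hab hk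
    (fun x _ => (hF.differentiable two_ne_zero x).hasDerivAt)
    (hderiv.continuous.intervalIntegrable a b), hper, sub_self, mul_zero, zero_sub, norm_mul,
    norm_neg, norm_mul, ← Complex.ofReal_sub, Complex.norm_of_nonneg hlen.le]
  have hk' : ‖1 / (-2 * π * I * k)‖ = 1 / (2 * π * |(k : ℝ)|) := by
    simp [abs_of_pos Real.pi_pos]
  calc ‖1 / (-2 * π * I * k)‖ * ((b - a) * ‖fourierCoeffOn hab (deriv F) k‖)
      ≤ 1 / (2 * π * |(k : ℝ)|) * ((b - a) * (C / |(k : ℝ)|)) := by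
        rw [hk']
        gcongr
        exact hC k hk
    _ = (b - a) * C / (2 * π) * (1 / (k : ℝ) ^ 2) := by
        rw [← sq_abs (k : ℝ)]
        field_simp

theorem hasSum_fourierCoeffOn_mul_fourier {F : ℝ → ℂ} (hF : ContinuousOn F (Icc a b))
    (hper : F a = F b) (hsummable : Summable fun k => ‖fourierCoeffOn hab F k‖) {w : ℝ}
    (hw : w ∈ Ioc a b) :
    HasSum (fun k => fourierCoeffOn hab F k * fourier k (w : AddCircle (b - a))) (F w) := by
  have : Fact (0 < b - a) := ⟨sub_pos.2 hab⟩
  have hlift : Continuous (AddCircle.liftIoc (b - a) a F) :=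
    AddCircle.liftIoc_continuous (by rwa [add_sub_cancel]) (by rwa [add_sub_cancel])
  have hsum := has_pointwise_sum_fourier_series_of_summable (f := ⟨_, hlift⟩)
    (hsummable.of_norm : Summable (fourierCoeffOn hab F)) w
  have hval : AddCircle.liftIoc (b - a) a F w = F w :=
    AddCircle.liftIoc_coe_apply (by rwa [add_sub_cancel])
  rw [← hval]
  exact hsum

/-- The symmetric partial sums of the Fourier series of `F` on `[a, b]`. -/
noncomputable def fourierPartialSum (F : ℝ → ℂ) (N : ℕ) (w : ℝ) : ℂ :=
  ∑ k ∈ Finset.Icc (-(N : ℤ)) N, fourierCoeffOn hab F k * fourier k (w : AddCircle (b - a))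

theorem fourierCoeffOn_const {k : ℤ} (hk : k ≠ 0) (c : ℂ) :
    fourierCoeffOn hab (fun _ => c) k = 0 := by
  rw [fourierCoeffOn_of_hasDerivAt hab hk (fun x _ => hasDerivAt_const x c)
    intervalIntegrable_const]
  simp [fourierCoeffOn_eq_integral]

theorem fourierCoeffOn_ofReal {k : ℤ} (hk : k ≠ 0) :
    fourierCoeffOn hab (fun t => (t : ℂ)) k =
      -(b - a) / (2 * π * I * k) * fourier (-k) (a : AddCircle (b - a)) := by
  have hderiv : ∀ x ∈ [[a, b]], HasDerivAt (fun t : ℝ => (t : ℂ)) 1 x :=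
    fun x _ => (hasDerivAt_id (x : ℂ)).comp_ofReal
  rw [fourierCoeffOn_of_hasDerivAt hab hk hderiv intervalIntegrable_const,
    fourierCoeffOn_const hab hk]
  ring

theorem fourierCoeffOn_ofReal_zero : fourierCoeffOn hab (fun t => (t : ℂ)) 0 = (a + b) / 2 := by
  have hlen : (b - a : ℂ) ≠ 0 := by exact_mod_cast (sub_pos.2 hab).ne'
  simp only [fourierCoeffOn_eq_integral, neg_zero, fourier_zero, one_smul, Complex.real_smul]
  rw [intervalIntegral.integral_ofReal, integral_id]
  push_cast
  field_simp
  ring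

theorem fourierCoeffOn_ofReal_mul_fourier_add_neg {k : ℤ} (hk : k ≠ 0) (w : ℝ) :
    fourierCoeffOn hab (fun t => (t : ℂ)) k * fourier k (w : AddCircle (b - a)) +
        fourierCoeffOn hab (fun t => (t : ℂ)) (-k) * fourier (-k) (w : AddCircle (b - a)) =
      -((b - a) / π * (Real.sin (k * (2 * π * (w - a) / (b - a))) / k) : ℝ) := by
  have hterm : ∀ m : ℤ, fourier (-m) (a : AddCircle (b - a)) * fourier m (w : AddCircle (b - a)) =
      Complex.exp (m * (2 * π * (w - a) / (b - a)) * I) := by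
    intro m
    rw [fourier_coe_apply, fourier_coe_apply, ← Complex.exp_add]
    push_cast
    ring_nf
  have hkC : (k : ℂ) ≠ 0 := by exact_mod_cast hk
  rw [fourierCoeffOn_ofReal hab hk, fourierCoeffOn_ofReal hab (neg_ne_zero.2 hk),
    mul_assoc (-(b - a) / _ : ℂ), mul_assoc (-(b - a) / _ : ℂ), hterm k, hterm (-k)]
  push_cast
  rw [Complex.sin]
  field_simp
  rw [Complex.I_sq]
  ring

theorem fourierPartialSum_ofReal (N : ℕ) (w : ℝ) :
    fourierPartialSum hab (fun t => (t : ℂ)) N w =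
      ((a + b) / 2 - (b - a) / π * sawSum N (2 * π * (w - a) / (b - a)) : ℝ) := by
  unfold fourierPartialSum
  induction N with
  | zero => simp [fourierCoeffOn_ofReal_zero, sawSum]
  | succ N ih =>
    rw [Nat.cast_succ, Finset.sum_Icc_succ_eq_add_endpoints, ih,
      fourierCoeffOn_ofReal_mul_fourier_add_neg hab (by positivity), sawSum, sawSum,
      Finset.sum_range_succ]
    push_cast
    ring

theorem fourierPartialSum_eq_add {F G : ℝ → ℂ} {α : ℂ} (hG : IntervalIntegrable G volume a b)
    (hFG : ∀ t, F t = G t + α * t) (N : ℕ) (w : ℝ) :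
    fourierPartialSum hab F N w =
      fourierPartialSum hab G N w + α * fourierPartialSum hab (fun t => (t : ℂ)) N w := by
  simp only [fourierPartialSum, Finset.mul_sum, ← Finset.sum_add_distrib]
  refine Finset.sum_congr rfl fun k _ => ?_
  rw [funext hFG, fourierCoeffOn_add hab hG (Continuous.intervalIntegrable (by fun_prop) a b),
    fourierCoeffOn.const_mul]
  ring

theorem two_pi_mul_div_mem_Ioo {w : ℝ} (hw : w ∈ Ioo a b) :
    2 * π * (w - a) / (b - a) ∈ Ioo 0 (2 * π) := by
  have hlen : 0 < b - a := by linarith [hw.1, hw.2]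
  have hwa : 0 < w - a := by linarith [hw.1]
  refine ⟨by positivity, ?_⟩
  rw [div_lt_iff₀ hlen]
  gcongr
  exact hw.2

theorem exists_norm_fourierPartialSum_ofReal_le :
    ∃ C, ∀ w ∈ Ioo a b, ∀ N, ‖fourierPartialSum hab (fun t => (t : ℂ)) N w‖ ≤ C := by
  refine ⟨|(a + b) / 2| + |(b - a) / π| * (2 * π), fun w hw N => ?_⟩
  rw [fourierPartialSum_ofReal, Complex.norm_real]
  refine (norm_sub_le _ _).trans ?_
  rw [norm_mul]
  exact add_le_add_right (mul_le_mul_of_nonneg_left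
    (abs_sawSum_le N (two_pi_mul_div_mem_Ioo hw)) (abs_nonneg _)) _

theorem tendsto_fourierPartialSum_ofReal {w : ℝ} (hw : w ∈ Ioo a b) :
    Tendsto (fun N => fourierPartialSum hab (fun t => (t : ℂ)) N w) atTop (𝓝 w) := by
  have hlim := ((tendsto_sawSum (two_pi_mul_div_mem_Ioo hw)).const_mul ((b - a) / π)).const_sub
    ((a + b) / 2)
  have hval : (a + b) / 2 - (b - a) / π * ((π - 2 * π * (w - a) / (b - a)) / 2) = w := by
    have hlen : b - a ≠ 0 := (sub_pos.2 hab).ne'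
    field_simp
    ring
  rw [hval] at hlim
  simp only [fourierPartialSum_ofReal]
  exact (Complex.continuous_ofReal.tendsto w).comp hlim

-- Subtracting a linear function makes `F` periodic, with an absolutely convergent Fourier series;
-- the linear function has the sawtooth series.
theorem exists_fourierPartialSum_eq {F : ℝ → ℂ} (hF : ContDiff ℝ 2 F) :
    ∃ (G : ℝ → ℂ) (α : ℂ), ContDiff ℝ 2 G ∧ G a = G b ∧ (∀ t, F t = G t + α * t) ∧
      ∀ N w, fourierPartialSum hab F N w =
        fourierPartialSum hab G N w + α * fourierPartialSum hab (fun t => (t : ℂ)) N w := by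
  set α : ℂ := (F b - F a) / (b - a)
  have hlen : (b - a : ℂ) ≠ 0 := by exact_mod_cast (sub_pos.2 hab).ne'
  have hG : ContDiff ℝ 2 fun t : ℝ => F t - α * t :=
    hF.sub (contDiff_const.mul Complex.ofRealCLM.contDiff)
  have hFG : ∀ t : ℝ, F t = F t - α * t + α * t := fun t => by ring
  refine ⟨_, α, hG, ?_, hFG,
    fourierPartialSum_eq_add hab (hG.continuous.intervalIntegrable a b) hFG⟩
  linear_combination div_mul_cancel₀ (F b - F a) hlen

theorem norm_fourierPartialSum_le {F : ℝ → ℂ}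
    (hF : Summable fun k => ‖fourierCoeffOn hab F k‖) (N : ℕ) (w : ℝ) :
    ‖fourierPartialSum hab F N w‖ ≤ ∑' k, ‖fourierCoeffOn hab F k‖ := by
  refine (norm_sum_le _ _).trans ?_
  simp only [norm_mul, norm_fourier_coe_apply, mul_one]
  exact hF.sum_le_tsum _ fun k _ => norm_nonneg _

theorem exists_norm_fourierPartialSum_le {F : ℝ → ℂ} (hF : ContDiff ℝ 2 F) :
    ∃ C, ∀ w ∈ Ioo a b, ∀ N, ‖fourierPartialSum hab F N w‖ ≤ C := by
  obtain ⟨G, α, hG, hper, -, hsplit⟩ := exists_fourierPartialSum_eq hab hF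
  obtain ⟨C, hC⟩ := exists_norm_fourierPartialSum_ofReal_le hab
  refine ⟨∑' k, ‖fourierCoeffOn hab G k‖ + ‖α‖ * C, fun w hw N => ?_⟩
  rw [hsplit]
  refine (norm_add_le _ _).trans (add_le_add
    (norm_fourierPartialSum_le hab (summable_norm_fourierCoeffOn hab hG hper) N w) ?_)
  rw [norm_mul]
  exact mul_le_mul_of_nonneg_left (hC w hw N) (norm_nonneg α)

theorem tendsto_fourierPartialSum {F : ℝ → ℂ} (hF : ContDiff ℝ 2 F) {w : ℝ} (hw : w ∈ Ioo a b) :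
    Tendsto (fun N => fourierPartialSum hab F N w) atTop (𝓝 (F w)) := by
  obtain ⟨G, α, hG, hper, hFG, hsplit⟩ := exists_fourierPartialSum_eq hab hF
  have hG_lim : Tendsto (fun N => fourierPartialSum hab G N w) atTop (𝓝 (G w)) :=
    hasSum_symmetricIcc_iff.1 ((hasSum_fourierCoeffOn_mul_fourier hab hG.continuous.continuousOn
      hper (summable_norm_fourierCoeffOn hab hG hper) (Ioo_subset_Ioc_self hw)).mono_left
        (symmetricIcc ℤ).le_atTop)
  simp only [hsplit, hFG w]
  exact hG_lim.add ((tendsto_fourierPartialSum_ofReal hab hw).const_mul α)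

theorem hasSum_fourierCoeffOn_mul {F G : ℝ → ℂ} (hF : ContinuousOn F (Icc a b)) (hper : F a = F b)
    (hsummable : Summable fun k => ‖fourierCoeffOn hab F k‖)
    (hG : IntervalIntegrable G volume a b) (k : ℤ) :
    HasSum (fun m => fourierCoeffOn hab F m * fourierCoeffOn hab G (k - m))
      (fourierCoeffOn hab (fun t => F t * G t) k) := by
  set e : ℤ → ℝ → ℂ := fun m t => fourier m (t : AddCircle (b - a))
  have hGe : ∀ m, IntervalIntegrable (fun t => e m t * G t) volume a b := fun m =>
    hG.continuousOn_mul (continuous_fourier_coe (b - a) m).continuousOn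
  have hsum : HasSum (fun m => ∫ t in a..b, fourierCoeffOn hab F m * e m t * (e (-k) t * G t))
      (∫ t in a..b, F t * (e (-k) t * G t)) := by
    refine intervalIntegral.hasSum_integral_of_dominated_convergence
      (fun m t => ‖fourierCoeffOn hab F m‖ * ‖G t‖) (fun m => ?_) (fun m => ?_) ?_ ?_ ?_
    · exact (((continuous_fourier_coe (b - a) m).aestronglyMeasurable.const_mul _).mul
        (hGe (-k)).aestronglyMeasurable_restrict_uIoc)
    · refine Eventually.of_forall fun t _ => le_of_eq ?_
      simp only [norm_mul, e, norm_fourier_coe_apply, mul_one, one_mul]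
    · exact Eventually.of_forall fun t _ => hsummable.mul_right _
    · simp only [tsum_mul_right]
      exact hG.norm.const_mul _
    · refine Eventually.of_forall fun t ht => ?_
      rw [uIoc_of_le hab.le] at ht
      exact (hasSum_fourierCoeffOn_mul_fourier hab hF hper hsummable ht).mul_right _
  have hterm : ∀ m, fourierCoeffOn hab F m * fourierCoeffOn hab G (k - m) = (1 / (b - a) : ℝ) *
      ∫ t in a..b, fourierCoeffOn hab F m * e m t * (e (-k) t * G t) := by
    intro m
    have hshift : ∀ t, fourierCoeffOn hab F m * e m t * (e (-k) t * G t) =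
        fourierCoeffOn hab F m * (e (-(k - m)) t * G t) := by
      intro t
      rw [show -(k - m) = m + -k by ring]
      simp only [e, fourier_add]
      ring
    simp only [hshift, intervalIntegral.integral_const_mul, fourierCoeffOn_eq_integral G,
      Complex.real_smul, smul_eq_mul, e]
    ring
  have hlim : fourierCoeffOn hab (fun t => F t * G t) k = (1 / (b - a) : ℝ) *
      ∫ t in a..b, F t * (e (-k) t * G t) := by
    simp only [fourierCoeffOn_eq_integral, Complex.real_smul, smul_eq_mul, e, mul_left_comm]
  rw [hlim, funext hterm]
  exact hsum.mul_left _

end Fourier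

section HalfTurn

open Complex (I)
open Filter Set
open scoped Real Topology

/-- The Fourier coefficients on the interval `[-π/2, π/2]`, the range of the elevation relative to
broadside. -/
noncomputable def halfTurnCoeff (F : ℝ → ℂ) (k : ℤ) : ℂ :=
  fourierCoeffOn (neg_lt_self Real.pi_div_two_pos) F k

theorem fourier_half_turn_apply (k : ℤ) (t : ℝ) :
    fourier k (t : AddCircle (π / 2 - -(π / 2))) = Complex.exp (2 * I * k * t) := by
  have hpi : (π : ℂ) ≠ 0 := Complex.ofReal_ne_zero.2 Real.pi_ne_zero
  rw [fourier_coe_apply]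
  congr 1
  push_cast
  field_simp
  ring

theorem halfTurnCoeff_eq_integral (F : ℝ → ℂ) (k : ℤ) :
    halfTurnCoeff F k =
      1 / π * ∫ t in -(π / 2)..π / 2, F t * Complex.exp (2 * I * (-k : ℤ) * t) := by
  simp only [halfTurnCoeff, fourierCoeffOn_eq_integral, fourier_half_turn_apply, sub_neg_eq_add,
    add_halves, Complex.real_smul, smul_eq_mul, mul_comm (Complex.exp _)]
  push_cast
  rfl

/-- The vertical factor `e^{-jz sin t}` of an array response, at elevation `t` relative to
broadside. -/
noncomputable def expSin (z t : ℝ) : ℂ := Complex.exp (I * (z * Complex.sin (-t)))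

/-- The horizontal factor `J_n(z cos t)` of an array response, at elevation `t` relative to
broadside, after the expansion in the azimuth. -/
noncomputable def besselCos (n : ℕ) (z t : ℝ) : ℂ := besselJ n (z * Real.cos t)

theorem contDiff_expSin (z : ℝ) : ContDiff ℝ 2 (expSin z) :=
  (contDiff_const.mul (contDiff_const.mul
    ((Complex.contDiff_sin.restrict_scalars ℝ).comp Complex.ofRealCLM.contDiff.neg))).cexp

theorem contDiff_besselCos (n : ℕ) (z : ℝ) : ContDiff ℝ 2 (besselCos n z) :=
  ((differentiable_besselJ_natCast n).contDiff.restrict_scalars ℝ).comp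
    (contDiff_const.mul (Complex.ofRealCLM.contDiff.comp Real.contDiff_cos))

theorem integral_exp_neg_mul_eq_sinc (q : ℝ) :
    ∫ t in -(π / 2)..π / 2, Complex.exp (I * q * -t) = π * Real.sinc (q * (π / 2)) := by
  rcases eq_or_ne q 0 with rfl | hq
  · simp
  have hqC : (q : ℂ) ≠ 0 := Complex.ofReal_ne_zero.2 hq
  calc ∫ t in -(π / 2)..π / 2, Complex.exp (I * q * -t)
      = ∫ t in -(π / 2)..π / 2, Complex.exp ((-q * t : ℝ) * I) := by
        congr with t
        push_cast
        ring_nf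
    _ = (-q)⁻¹ • -∫ t in -(q * (π / 2))..q * (π / 2), Complex.exp (t * I) := by
        rw [intervalIntegral.integral_comp_mul_left (fun t : ℝ => Complex.exp (t * I))
          (neg_ne_zero.2 hq), neg_mul_neg, neg_mul, intervalIntegral.integral_symm]
    _ = π * Real.sinc (q * (π / 2)) := by
        rw [integral_exp_mul_I_eq_sinc, Complex.real_smul]
        push_cast
        field_simp

theorem sinc_int_mul_pi (r : ℤ) : Real.sinc (r * π) = if r = 0 then 1 else 0 := by
  split_ifs with hr
  · simp [hr]
  · rw [Real.sinc_of_ne_zero (mul_ne_zero (Int.cast_ne_zero.2 hr) Real.pi_ne_zero),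
      Real.sin_int_mul_pi, zero_div]

theorem sinc_two_mul_add_one_mul_pi_div_two (r : ℤ) :
    Real.sinc ((2 * r + 1) * (π / 2)) = 2 * (-1) ^ r / (π * (2 * r + 1)) := by
  have hr : (2 * r + 1 : ℝ) ≠ 0 := by exact_mod_cast (by lia : 2 * r + 1 ≠ 0)
  rw [Real.sinc_of_ne_zero (mul_ne_zero hr Real.pi_div_two_pos.ne'),
    show (2 * r + 1) * (π / 2) = r * π + π / 2 by ring, Real.sin_add_pi_div_two,
    Real.cos_int_mul_pi]
  field_simp

/-- The contribution of the `m`-th term of the Jacobi–Anger series of `expSin z` to its `k`-th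
Fourier coefficient. -/
noncomputable def besselSincTerm (z : ℂ) (k m : ℤ) : ℂ :=
  besselJ m z * Real.sinc ((m + 2 * k) * (π / 2))

theorem hasSum_besselSincTerm (z : ℝ) (k : ℤ) :
    HasSum (besselSincTerm z k) (halfTurnCoeff (expSin z) k) := by
  have hsum : HasSum (fun m : ℤ => ∫ t in -(π / 2)..π / 2,
        besselJ m z * Complex.exp (I * m * -t) * Complex.exp (2 * I * (-k : ℤ) * t))
      (∫ t in -(π / 2)..π / 2, expSin z t * Complex.exp (2 * I * (-k : ℤ) * t)) := by
    refine intervalIntegral.hasSum_integral_of_dominated_convergence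
      (fun m _ => ‖besselJ m z‖) (fun m => ?_) (fun m => ?_) ?_ ?_ ?_
    · exact Continuous.aestronglyMeasurable (by fun_prop)
    · refine Eventually.of_forall fun t _ => le_of_eq ?_
      simp [Complex.norm_exp]
    · exact Eventually.of_forall fun t _ => summable_norm_besselJ_intCast z
    · exact intervalIntegrable_const
    · exact Eventually.of_forall fun t _ => (hasSum_besselJ_exp_sin z (-t)).mul_right _
  have hterm (m : ℤ) : besselSincTerm z k m = 1 / π * ∫ t in -(π / 2)..π / 2,
      besselJ m z * Complex.exp (I * m * -t) * Complex.exp (2 * I * (-k : ℤ) * t) := by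
    have hexp (t : ℝ) : besselJ m z * Complex.exp (I * m * -t) *
          Complex.exp (2 * I * (-k : ℤ) * t) =
        besselJ m z * Complex.exp (I * (m + 2 * k : ℝ) * -t) := by
      rw [mul_assoc, ← Complex.exp_add]
      push_cast
      ring_nf
    have hpi : (π : ℂ) ≠ 0 := Complex.ofReal_ne_zero.2 Real.pi_ne_zero
    simp only [hexp, intervalIntegral.integral_const_mul, integral_exp_neg_mul_eq_sinc,
      besselSincTerm]
    field_simp
  rw [halfTurnCoeff_eq_integral, funext hterm]
  exact hsum.mul_left _

theorem hasSum_two_mul_add_one {f : ℤ → ℂ} {s e : ℂ} (hf : HasSum f s)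
    (heven : HasSum (fun r => f (2 * r)) e) : HasSum (fun r => f (2 * r + 1)) (s - e) := by
  have hcompl : (range fun r : ℤ => 2 * r)ᶜ = range fun r : ℤ => 2 * r + 1 := by
    ext m
    simp only [mem_compl_iff, mem_range, not_exists]
    exact ⟨fun h => ⟨m / 2, by have := h (m / 2); lia⟩, by rintro ⟨r, rfl⟩; lia⟩
  have hinj_even : Function.Injective fun r : ℤ => 2 * r := fun _ _ h => by simpa using h
  have hinj_odd : Function.Injective fun r : ℤ => 2 * r + 1 := fun _ _ h => by simpa using h
  have hrange : HasSum (f ∘ (↑) : ↥(range fun r : ℤ => 2 * r) → ℂ) e :=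
    hinj_even.hasSum_range_iff.2 heven
  have hodd := hrange.hasSum_compl_iff.2 ((add_sub_cancel e s).symm ▸ hf)
  rw [hcompl] at hodd
  exact hinj_odd.hasSum_range_iff.1 hodd

theorem besselJ_neg_two_mul_intCast (k : ℤ) (z : ℂ) : besselJ (-(2 * k)) z = besselJ (2 * k) z := by
  have hnat (n : ℕ) : besselJ (-(2 * n)) z = besselJ (2 * n) z := by
    simpa using besselJ_neg_natCast (2 * n) z
  obtain ⟨n, rfl | rfl⟩ := k.eq_nat_or_neg
  · exact hnat n
  · simpa using (hnat n).symm

theorem hasSum_besselSincTerm_two_mul (z : ℂ) (k : ℤ) :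
    HasSum (fun r => besselSincTerm z k (2 * r)) (besselJ (2 * k) z) := by
  have hterm (r : ℤ) : besselSincTerm z k (2 * r) = if r = -k then besselJ (2 * k) z else 0 := by
    have hsinc : Real.sinc (((2 * r : ℤ) + 2 * k) * (π / 2)) = if r + k = 0 then 1 else 0 := by
      rw [← sinc_int_mul_pi]
      push_cast
      ring_nf
    simp only [besselSincTerm, hsinc, ← eq_neg_iff_add_eq_zero]
    split_ifs with hr
    · simp [hr, besselJ_neg_two_mul_intCast]
    · simp
  simpa only [hterm] using hasSum_ite_eq (-k) (besselJ (2 * k) z)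

theorem besselSincTerm_two_mul_add_one (z : ℂ) (k r : ℤ) :
    besselSincTerm z k (2 * r + 1) =
      besselJ (2 * r + 1) z * (2 * (-1) ^ (r + k) / (π * (2 * (r + k) + 1))) := by
  have hsinc := sinc_two_mul_add_one_mul_pi_div_two (r + k)
  push_cast at hsinc
  rw [besselSincTerm]
  push_cast
  rw [show (2 * r + 1 + 2 * k : ℝ) = 2 * (r + k) + 1 by ring, hsinc]
  push_cast
  rfl

theorem four_div_pi_mul_gTerm_succPNat (n₁ n₂ : ℤ) (z : ℝ) (j : ℕ) :
    4 / π * gTerm n₁ n₂ z j.succPNat = besselSincTerm z (n₁ + n₂) (2 * j + 1) +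
      besselSincTerm z (n₁ + n₂) (2 * -(j + 1) + 1) := by
  set s : ℤ := (j + 1 : ℕ) - n₁ - n₂ with hs
  have hsign_pos : (-1 : ℂ) ^ (j + (n₁ + n₂)) = -(-1) ^ s := by
    rw [show j + (n₁ + n₂) = s + (2 * (n₁ + n₂ - 1) + 1) by lia, zpow_add₀ (by simp),
      Odd.neg_one_zpow (odd_two_mul_add_one _), mul_neg_one]
  have hsign_neg : (-1 : ℂ) ^ (-(j + 1) + (n₁ + n₂)) = (-1) ^ s := by
    rw [show -(j + 1) + (n₁ + n₂) = -s by lia, zpow_neg, ← inv_zpow, inv_neg_one]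
  have hJ_neg : besselJ (2 * (-(j + 1) : ℤ) + 1) z = -besselJ (2 * j + 1) z := by
    have hneg := besselJ_neg_natCast (2 * j + 1) z
    rw [Odd.neg_one_pow (odd_two_mul_add_one j), neg_one_mul] at hneg
    push_cast at hneg ⊢
    rw [← hneg]
    ring_nf
  have hJ : besselJ (2 * (j.succPNat : ℕ) - 1) z = besselJ (2 * j + 1) z := by
    push_cast [Nat.succPNat_coe, Nat.succ_eq_add_one]
    ring_nf
  have hden_pos : (2 * (j + (n₁ + n₂)) + 1 : ℂ) ≠ 0 := by
    exact_mod_cast (by lia : 2 * (j + (n₁ + n₂)) + 1 ≠ 0)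
  have hden_neg : (2 * (j - (n₁ + n₂)) + 1 : ℂ) ≠ 0 := by
    exact_mod_cast (by lia : 2 * (j - (n₁ + n₂)) + 1 ≠ 0)
  rw [besselSincTerm_two_mul_add_one, besselSincTerm_two_mul_add_one, hsign_pos, hsign_neg,
    hJ_neg, gTerm, hJ, Nat.succPNat_coe, Nat.succ_eq_add_one, ← hs]
  push_cast
  rw [show (2 * (j + 1) - 1 : ℂ) ^ 2 - 4 * (n₁ + n₂) ^ 2 =
    (2 * (j + (n₁ + n₂)) + 1) * (2 * (j - (n₁ + n₂)) + 1) by ring,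
    show (2 * (-(j + 1) + (n₁ + n₂)) + 1 : ℂ) = -(2 * (j - (n₁ + n₂)) + 1) by ring]
  field_simp
  ring

theorem hasSum_gTerm (n₁ n₂ : ℤ) (z : ℝ) :
    HasSum (fun k => 4 / π * gTerm n₁ n₂ z k)
      (halfTurnCoeff (expSin z) (n₁ + n₂) - besselJ (2 * (n₁ + n₂)) z) := by
  have hodd := (hasSum_two_mul_add_one (hasSum_besselSincTerm z (n₁ + n₂))
    (hasSum_besselSincTerm_two_mul z (n₁ + n₂))).nat_add_neg_add_one
  rw [← Equiv.pnatEquivNat.symm.hasSum_iff]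
  simp only [← four_div_pi_mul_gTerm_succPNat] at hodd
  push_cast at hodd
  exact hodd

theorem summable_gTerm (n₁ n₂ : ℤ) (z : ℝ) : Summable (gTerm n₁ n₂ z) := by
  have hpi : (4 / π : ℂ) ≠ 0 := by simp [Real.pi_ne_zero]
  exact (summable_mul_left_iff hpi).1 (hasSum_gTerm n₁ n₂ z).summable

theorem gFun_eq_halfTurnCoeff (n₁ n₂ : ℤ) (z : ℝ) :
    gFun n₁ n₂ z = halfTurnCoeff (expSin z) (n₁ + n₂) := by
  rw [gFun, ← tsum_mul_left, (hasSum_gTerm n₁ n₂ z).tsum_eq, add_sub_cancel]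

end HalfTurn

section TripleSeries

open Complex (I)
open Filter
open scoped Real Topology

theorem vTerm_eq_halfTurnCoeff_mul (n n₁ n₂ : ℤ) (z₁ z₂ : ℝ) : vTerm n n₁ n₂ z₁ z₂ =
    halfTurnCoeff (besselCos n.natAbs z₁) (-n₂) * halfTurnCoeff (expSin z₂) (n₁ - -n₂) := by
  have hprod := besselJ_sub_mul_besselJ_add n.natAbs n₂ (z₁ / 2)
  rw [mul_div_cancel₀ (z₁ : ℂ) two_ne_zero] at hprod
  rw [vTerm, gFun_eq_halfTurnCoeff, sub_neg_eq_add, ← Int.cast_abs, ← Nat.cast_natAbs, hprod,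
    halfTurnCoeff_eq_integral (besselCos _ _), neg_neg]
  rfl

/-- The response of a pair of antennas at elevation `t` relative to broadside, in the `n`-th
azimuthal mode. -/
noncomputable def modeResponse (n : ℤ) (z₁ z₂ t : ℝ) : ℂ :=
  besselCos n.natAbs z₁ t * expSin z₂ t

theorem contDiff_modeResponse (n : ℤ) (z₁ z₂ : ℝ) : ContDiff ℝ 2 (modeResponse n z₁ z₂) :=
  (contDiff_besselCos n.natAbs z₁).mul (contDiff_expSin z₂)

theorem hasSum_vTerm (n n₁ : ℤ) (z₁ z₂ : ℝ) :
    HasSum (fun n₂ => vTerm n n₁ n₂ z₁ z₂) (halfTurnCoeff (modeResponse n z₁ z₂) n₁) := by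
  have hcos := contDiff_besselCos n.natAbs z₁
  have hper : besselCos n.natAbs z₁ (-(π / 2)) = besselCos n.natAbs z₁ (π / 2) := by
    simp [besselCos]
  have hconv := hasSum_fourierCoeffOn_mul (neg_lt_self Real.pi_div_two_pos)
    hcos.continuous.continuousOn hper (summable_norm_fourierCoeffOn _ hcos hper)
    ((contDiff_expSin z₂).continuous.intervalIntegrable _ _) n₁
  rw [← (Equiv.neg ℤ).hasSum_iff] at hconv
  simp only [vTerm_eq_halfTurnCoeff_mul]
  exact hconv

theorem chiCF_two_mul (ν : Measure ℝ) (k : ℤ) :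
    chiCF ν (2 * k) = ∫ θ, fourier k ((θ - π / 2 : ℝ) : AddCircle (π / 2 - -(π / 2))) ∂ν := by
  rw [chiCF, charFun_apply_real, integral_map (by fun_prop) (by fun_prop)]
  congr with θ
  rw [fourier_half_turn_apply]
  push_cast
  ring_nf

theorem continuous_fourier_sub_half_pi (k : ℤ) :
    Continuous fun θ : ℝ => fourier k ((θ - π / 2 : ℝ) : AddCircle (π / 2 - -(π / 2))) :=
  (continuous_fourier_coe _ k).comp (by fun_prop)

theorem continuous_fourierPartialSum {a b : ℝ} (hab : a < b) (F : ℝ → ℂ) (N : ℕ) :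
    Continuous (fourierPartialSum hab F N) :=
  continuous_finsetSum _ fun k _ => continuous_const.mul (continuous_fourier_coe (b - a) k)

theorem sum_vMid_eq_integral (ν : Measure ℝ) [IsFiniteMeasure ν] (n : ℤ) (z₁ z₂ : ℝ) (N : ℕ) :
    ∑ k ∈ Finset.Icc (-(N : ℤ)) N, vMid ν n k z₁ z₂ =
      ∫ θ, fourierPartialSum (neg_lt_self Real.pi_div_two_pos) (modeResponse n z₁ z₂) N
        (θ - π / 2) ∂ν := by
  simp only [fourierPartialSum]
  rw [integral_finsetSum _ fun k _ => Integrable.const_mul (Integrable.of_bound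
    (continuous_fourier_sub_half_pi k).aestronglyMeasurable 1
    (Eventually.of_forall fun θ => (norm_fourier_coe_apply _ _ _).le)) _]
  refine Finset.sum_congr rfl fun k _ => ?_
  rw [vMid, (hasSum_vTerm n k z₁ z₂).tsum_eq, chiCF_two_mul, mul_comm, ← integral_const_mul]
  rfl

theorem hasSum_vMid {ν : Measure ℝ} [IsFiniteMeasure ν] (hν : ∀ᵐ θ ∂ν, θ ∈ Set.Ioo 0 π) (n : ℤ)
    (z₁ z₂ : ℝ) :
    HasSum (fun n₁ => vMid ν n n₁ z₁ z₂) (∫ θ, modeResponse n z₁ z₂ (θ - π / 2) ∂ν)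
      (symmetricIcc ℤ) := by
  have hpos : -(π / 2) < π / 2 := neg_lt_self Real.pi_div_two_pos
  have hF := contDiff_modeResponse n z₁ z₂
  have hmem : ∀ᵐ θ ∂ν, θ - π / 2 ∈ Set.Ioo (-(π / 2)) (π / 2) := by
    filter_upwards [hν] with θ hθ
    constructor <;> linarith [hθ.1, hθ.2]
  obtain ⟨C, hC⟩ := exists_norm_fourierPartialSum_le hpos hF
  simp only [hasSum_symmetricIcc_iff, sum_vMid_eq_integral]
  refine tendsto_integral_of_dominated_convergence (fun _ => C) (fun N => ?_)
    (integrable_const _) (fun N => ?_) ?_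
  · exact ((continuous_fourierPartialSum hpos _ N).comp (by fun_prop)).aestronglyMeasurable
  · filter_upwards [hmem] with θ hθ using hC _ hθ N
  · filter_upwards [hmem] with θ hθ using tendsto_fourierPartialSum hpos hF hθ

/-- The response `e^{j(z₁ sin θ sin(φ + A) + z₂ cos θ)}` of a pair of antennas to a ray of azimuth
and elevation `q = (φ, θ)`. -/
noncomputable def pairResponse (A z₁ z₂ : ℝ) (q : ℝ × ℝ) : ℂ :=
  Complex.exp (I * (z₁ * Real.sin q.2 * Real.sin (q.1 + A) + z₂ * Real.cos q.2 : ℝ))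

variable {μ ν : Measure ℝ} [IsFiniteMeasure μ] [IsFiniteMeasure ν]

theorem vOut_eq_integral (hν : ∀ᵐ θ ∂ν, θ ∈ Set.Ioo 0 π) (n : ℤ) (A z₁ z₂ : ℝ) :
    vOut μ ν n A z₁ z₂ = ∫ q, besselJ n (z₁ * Real.sin q.2 : ℝ) *
      Complex.exp (I * n * (q.1 + A : ℝ)) * Complex.exp (I * (z₂ * Real.cos q.2 : ℝ))
        ∂(μ.prod ν) := by
  rw [vOut, (hasSum_vMid hν n z₁ z₂).tsum_eq, psiCF, charFun_apply_real, mul_assoc,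
    ← integral_prod_mul, ← integral_const_mul]
  refine integral_congr_ae (Eventually.of_forall fun q => ?_)
  have hazimuth : Complex.exp (I * n * (q.1 + A : ℝ)) =
      Complex.exp (I * n * A) * Complex.exp ((n : ℝ) * q.1 * I) := by
    rw [← Complex.exp_add]
    push_cast
    ring_nf
  have helevation : expSin z₂ (q.2 - π / 2) = Complex.exp (I * (z₂ * Real.cos q.2 : ℝ)) := by
    rw [expSin, ← Complex.ofReal_neg, ← Complex.ofReal_sin, neg_sub, Real.sin_pi_div_two_sub,
      Complex.ofReal_mul]
  dsimp only
  rw [besselJ_intCast, hazimuth, modeResponse, helevation, besselCos, Real.cos_sub_pi_div_two]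
  push_cast
  ring

theorem norm_exp_I_mul_ofReal (x : ℝ) : ‖Complex.exp (I * x)‖ = 1 := by
  rw [mul_comm, Complex.norm_exp_ofReal_mul_I]

theorem hasSum_vOut (hν : ∀ᵐ θ ∂ν, θ ∈ Set.Ioo 0 π) (A z₁ z₂ : ℝ) :
    HasSum (fun n => vOut μ ν n A z₁ z₂) (∫ q, pairResponse A z₁ z₂ q ∂(μ.prod ν)) := by
  simp only [vOut_eq_integral hν]
  refine hasSum_integral_of_dominated_convergence
    (fun n _ => |z₁ / 2| ^ n.natAbs / n.natAbs.factorial * Real.exp (|z₁ / 2| ^ 2))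
    (fun n => ?_) (fun n => Eventually.of_forall fun q => ?_) ?_ ?_ ?_
  · have hJ : Continuous (besselJ n) := by
      rw [funext (besselJ_intCast n)]
      exact continuous_const.mul (differentiable_besselJ_natCast n.natAbs).continuous
    exact Continuous.aestronglyMeasurable (by fun_prop)
  · rw [norm_mul, norm_mul, norm_exp_I_mul_ofReal, mul_assoc I, ← Complex.ofReal_intCast,
      ← Complex.ofReal_mul, norm_exp_I_mul_ofReal, mul_one, mul_one]
    refine norm_besselJ_intCast_le n ?_
    rw [← Complex.ofReal_ofNat, ← Complex.ofReal_div, Complex.norm_real, Real.norm_eq_abs,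
      mul_div_right_comm, abs_mul]
    exact mul_le_of_le_one_right (abs_nonneg _) (Real.abs_sin_le_one q.2)
  · exact Eventually.of_forall fun _ => summable_besselJ_bound _
  · exact integrable_const _
  · refine Eventually.of_forall fun q => ?_
    have hsum := (hasSum_besselJ_exp_sin (z₁ * Real.sin q.2 : ℝ) (q.1 + A : ℝ)).mul_right
      (Complex.exp (I * (z₂ * Real.cos q.2 : ℝ)))
    rw [← Complex.exp_add, ← mul_add] at hsum
    rw [pairResponse]
    push_cast at hsum ⊢
    exact hsum

theorem vSeries_eq_integral (hν : ∀ᵐ θ ∂ν, θ ∈ Set.Ioo 0 π) (A z₁ z₂ : ℝ) :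
    vSeries μ ν A z₁ z₂ = ∫ q, pairResponse A z₁ z₂ q ∂(μ.prod ν) :=
  (hasSum_vOut hν A z₁ z₂).tsum_eq

theorem vConverges (hν : ∀ᵐ θ ∂ν, θ ∈ Set.Ioo 0 π) (A z₁ z₂ : ℝ) : VConverges μ ν A z₁ z₂ :=
  ⟨fun n₁ n₂ => summable_gTerm n₁ n₂ z₂, fun n n₁ => (hasSum_vTerm n n₁ z₁ z₂).summable,
    fun n => (hasSum_vMid hν n z₁ z₂).summable, (hasSum_vOut hν A z₁ z₂).summable⟩

end TripleSeries

section SecondMoments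

open Complex (I)

variable {Ω : Type*} [MeasurableSpace Ω] {P : Measure Ω}

theorem integral_exp_int_mul_of_isUniform {X : Ω → ℝ} (hX : Measurable X)
    (hu : pdf.IsUniform X (Set.Icc 0 (2 * Real.pi)) P volume) {n : ℤ} (hn : n ≠ 0) :
    ∫ ω, Complex.exp (I * n * X ω) ∂P = 0 := by
  have hlaw : ∫ ω, Complex.exp (I * n * X ω) ∂P = ∫ x : ℝ, Complex.exp (I * n * x) ∂P.map X := by
    rw [integral_map hX.aemeasurable (by fun_prop)]
  have hperiod : Complex.exp (I * n * (2 * Real.pi : ℝ)) = 1 := by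
    rw [show I * n * (2 * Real.pi : ℝ) = n * (2 * Real.pi * I) by push_cast; ring,
      Complex.exp_int_mul_two_pi_mul_I]
  rw [hlaw, hu, ProbabilityTheory.cond, integral_smul_measure, integral_Icc_eq_integral_Ioc,
    ← intervalIntegral.integral_of_le (by positivity),
    integral_exp_mul_complex (mul_ne_zero Complex.I_ne_zero (by exact_mod_cast hn)), hperiod]
  simp

theorem integral_exp_sum_int_mul_of_isUniform {κ : Type*} [Fintype κ] {X : κ → Ω → ℝ}
    (hX : ∀ i, Measurable (X i)) (hindep : iIndepFun X P)
    (hu : ∀ i, pdf.IsUniform (X i) (Set.Icc 0 (2 * Real.pi)) P volume) {n : κ → ℤ} (hn : n ≠ 0) :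
    ∫ ω, Complex.exp (I * ∑ i, (n i : ℂ) * X i ω) ∂P = 0 := by
  obtain ⟨i, hi⟩ := Function.ne_iff.1 hn
  simp only [Finset.mul_sum, Complex.exp_sum, ← mul_assoc]
  rw [hindep.integral_fun_prod_comp (f := fun i (x : ℝ) => Complex.exp (I * n i * x))
    (fun i => (hX i).aemeasurable) fun i => by fun_prop]
  exact Finset.prod_eq_zero (Finset.mem_univ i) (integral_exp_int_mul_of_isUniform (hX i) (hu i) hi)

theorem ofReal_norm_sq (z : ℂ) : ((‖z‖ ^ 2 : ℝ) : ℂ) = z * star z := by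
  rw [Complex.star_def, RCLike.mul_conj]
  push_cast
  rfl

theorem memLp_two_mul_of_indepFun {X Y : Ω → ℂ} (hindep : IndepFun X Y P) (hX : MemLp X 2 P)
    (hY : MemLp Y 2 P) : MemLp (fun ω => X ω * Y ω) 2 P := by
  refine (memLp_two_iff_integrable_sq_norm
    (hX.aestronglyMeasurable.mul hY.aestronglyMeasurable)).2 ?_
  simp only [Pi.mul_apply, norm_mul, mul_pow]
  exact (hindep.comp (φ := fun z => ‖z‖ ^ 2) (ψ := fun z => ‖z‖ ^ 2) (by fun_prop)
    (by fun_prop)).integrable_mul ((memLp_two_iff_integrable_sq_norm hX.1).1 hX)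
    ((memLp_two_iff_integrable_sq_norm hY.1).1 hY)

theorem integral_norm_sq_sum {T : Type*} [Fintype T] {Z : T → Ω → ℂ}
    (hZ : ∀ p, MemLp (Z p) 2 P) :
    ((∫ ω, ‖∑ p, Z p ω‖ ^ 2 ∂P : ℝ) : ℂ) = ∑ p, ∑ q, ∫ ω, Z p ω * star (Z q ω) ∂P := by
  have hint : ∀ p q, Integrable (fun ω => Z p ω * star (Z q ω)) P := fun p q =>
    (hZ p).integrable_mul (hZ q).star
  rw [← integral_complex_ofReal]
  simp only [ofReal_norm_sq, star_sum, Finset.sum_mul_sum]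
  rw [integral_finsetSum _ fun p _ => integrable_finsetSum _ fun q _ => hint p q]
  exact Finset.sum_congr rfl fun p _ => integral_finsetSum _ fun q _ => hint p q

theorem memLp_two_sum_mul_of_indepFun {T : Type*} [Fintype T] {U Y : T → Ω → ℂ}
    (hU : ∀ p, MemLp (U p) 2 P) (hY : ∀ p, MemLp (Y p) 2 P)
    (hindep : ∀ p, IndepFun (U p) (Y p) P) : MemLp (fun ω => ∑ p, U p ω * Y p ω) 2 P :=
  memLp_finsetSum _ fun p _ => memLp_two_mul_of_indepFun (hindep p) (hU p) (hY p)

theorem integral_norm_sq_sum_mul_of_indepFun {T : Type*} [Fintype T] [DecidableEq T]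
    {U Y : T → Ω → ℂ} (hU : ∀ p, MemLp (U p) 2 P) (hY : ∀ p, MemLp (Y p) 2 P)
    (hindep : IndepFun (fun ω p => U p ω) (fun ω p => Y p ω) P)
    (horth : ∀ p q, ∫ ω, U p ω * star (U q ω) ∂P = if p = q then 1 else 0) :
    ∫ ω, ‖∑ p, U p ω * Y p ω‖ ^ 2 ∂P = ∑ p, ∫ ω, ‖Y p ω‖ ^ 2 ∂P := by
  have hprod : ∀ p q : T, Measurable fun u : T → ℂ => u p * star (u q) := fun p q =>
    Continuous.measurable (by fun_prop)
  have hpair : ∀ p q, ∫ ω, U p ω * Y p ω * star (U q ω * Y q ω) ∂P =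
      (if p = q then 1 else 0) * ∫ ω, Y p ω * star (Y q ω) ∂P := fun p q => by
    rw [← horth]
    refine Eq.trans (integral_congr_ae <| .of_forall fun ω => ?_)
      ((hindep.comp (hprod p q) (hprod p q)).integral_fun_mul_eq_mul_integral
        ((hU p).integrable_mul (hU q).star).1 ((hY p).integrable_mul (hY q).star).1)
    simp only [Function.comp_apply, star_mul']
    ring
  have hmem : ∀ p, MemLp (fun ω => U p ω * Y p ω) 2 P := fun p =>
    memLp_two_mul_of_indepFun (hindep.comp (measurable_pi_apply p) (measurable_pi_apply p))
      (hU p) (hY p)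
  rw [← Complex.ofReal_inj, integral_norm_sq_sum hmem]
  simp only [hpair, ite_mul, one_mul, zero_mul, Finset.sum_ite_eq, Finset.mem_univ, if_true,
    Complex.ofReal_sum, ← integral_complex_ofReal, ofReal_norm_sq]

section IdenticallyDistributed

variable {E ι : Type*} [MeasurableSpace E] [Fintype ι] {ρ : Measure E} {v : E → ι → ℂ}
  {X Y : Ω → E}

theorem memLp_two_comp_of_hasLaw {f : E → ℂ} (hf : MemLp f 2 ρ) (hX : HasLaw X ρ P) :
    MemLp (fun ω => f (X ω)) 2 P :=
  (hX.map_eq ▸ hf).comp_of_map hX.aemeasurable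

theorem memLp_two_comp_mul_comp_of_indepFun {f g : E → ℂ} (hf : MemLp f 2 ρ) (hg : MemLp g 2 ρ)
    (hX : HasLaw X ρ P) (hY : HasLaw Y ρ P) (hindep : IndepFun X Y P) :
    MemLp (fun ω => f (X ω) * g (Y ω)) 2 P :=
  memLp_two_mul_of_indepFun
    (hindep.comp₀ hX.aemeasurable hY.aemeasurable (hX.map_eq ▸ hf.1.aemeasurable)
      (hY.map_eq ▸ hg.1.aemeasurable))
    (memLp_two_comp_of_hasLaw hf hX) (memLp_two_comp_of_hasLaw hg hY)

theorem memLp_two_star_dotProduct (hv : ∀ m, MemLp (fun x => v x m) 2 ρ) (hX : HasLaw X ρ P)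
    (hY : HasLaw Y ρ P) (hindep : IndepFun X Y P) :
    MemLp (fun ω => star (v (X ω)) ⬝ᵥ v (Y ω)) 2 P :=
  memLp_finsetSum _ fun m _ =>
    memLp_two_comp_mul_comp_of_indepFun (hv m).star (hv m) hX hY hindep

theorem integral_norm_sq_star_dotProduct (hv : ∀ m, MemLp (fun x => v x m) 2 ρ)
    (hX : HasLaw X ρ P) (hY : HasLaw Y ρ P) (hindep : IndepFun X Y P) :
    ∫ ω, ‖star (v (X ω)) ⬝ᵥ v (Y ω)‖ ^ 2 ∂P =
      ∑ m, ∑ m', ‖∫ x, v x m * star (v x m') ∂ρ‖ ^ 2 := by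
  have hcorr : ∀ m m', AEStronglyMeasurable (fun x => v x m * star (v x m')) ρ := fun m m' =>
    (hv m).1.mul (hv m').star.1
  have hpair : ∀ m m', ∫ ω, star (v (X ω) m) * v (Y ω) m *
      star (star (v (X ω) m') * v (Y ω) m') ∂P =
      (∫ x, v x m * star (v x m') ∂ρ) * star (∫ x, v x m * star (v x m') ∂ρ) := fun m m' => by
    have hstar := (hcorr m m').star
    rw [mul_comm]
    refine Eq.trans (integral_congr_ae <| .of_forall fun ω => ?_)
      ((hindep.integral_fun_comp_mul_comp hX.aemeasurable hY.aemeasurable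
        (hX.map_eq.symm ▸ hstar) (hY.map_eq.symm ▸ hcorr m m')).trans
        (congrArg₂ (· * ·) ((hX.integral_comp hstar).trans integral_conj)
          (hY.integral_comp (hcorr m m'))))
    simp only [Pi.star_apply, star_mul', star_star]
    ring
  refine Complex.ofReal_inj.1 ((integral_norm_sq_sum fun m =>
    memLp_two_comp_mul_comp_of_indepFun (hv m).star (hv m) hX hY hindep).trans ?_)
  simp only [Pi.star_apply, hpair, Complex.ofReal_sum, ofReal_norm_sq]

end IdenticallyDistributed

end SecondMoments

namespace RayModel

open Complex (I)

variable {Ω : Type*} [MeasurableSpace Ω] {P : Measure Ω} {μ ν : Measure ℝ} {L C S : ℕ}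

/-- Pairs consisting of a ray of one user and a ray of another user. -/
abbrev RayPair (C S : ℕ) : Type := (Fin C × Fin S) × (Fin C × Fin S)

/-- The relative phase factor `e^{j(Θ' - Θ)}` of a ray `p.1` of user `l` and a ray `p.2` of user
`l'`; these are the orthonormal coefficients of the inner product `h_lᴴ h_{l'}`. -/
noncomputable def phaseFactor (R : RayModel P μ ν L C S) (l l' : Fin L)
    (p : RayPair C S) (ω : Ω) : ℂ :=
  Complex.exp (I * (R.phase l' p.2 ω - R.phase l p.1 ω : ℝ))

theorem measurable_phaseFactor (R : RayModel P μ ν L C S) (l l' : Fin L)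
    (p : RayPair C S) : Measurable (R.phaseFactor l l' p) := by
  have := R.measurable_phase l p.1
  have := R.measurable_phase l' p.2
  unfold phaseFactor
  fun_prop

theorem norm_phaseFactor (R : RayModel P μ ν L C S) (l l' : Fin L)
    (p : RayPair C S) (ω : Ω) : ‖R.phaseFactor l l' p ω‖ = 1 :=
  norm_exp_I_mul_ofReal _

theorem integral_phaseFactor_mul_star [IsProbabilityMeasure P] (R : RayModel P μ ν L C S)
    {l l' : Fin L} (hll' : l ≠ l') (p q : RayPair C S) :
    ∫ ω, R.phaseFactor l l' p ω * star (R.phaseFactor l l' q ω) ∂P = if p = q then 1 else 0 := by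
  split_ifs with hpq
  · subst hpq
    simp only [← ofReal_norm_sq, norm_phaseFactor]
    simp
  · set w : RayPair C S → Fin L × (Fin C × Fin S) → ℤ := fun p =>
      Pi.single (l', p.2) 1 - Pi.single (l, p.1) 1 with hw
    have hne : w p - w q ≠ 0 := fun h => hpq <| by
      have h₁ := congrFun h (l, p.1)
      have h₂ := congrFun h (l', p.2)
      refine Prod.ext (by_contra fun hne => ?_) (by_contra fun hne => ?_)
      · simp [hw, hll', hne] at h₁
      · simp [hw, hll'.symm, hne] at h₂
    have hphase : ∀ p ω, ∑ i, (w p i : ℂ) * R.phase i.1 i.2 ω =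
        R.phase l' p.2 ω - R.phase l p.1 ω := fun p ω => by
      simp [hw, sub_mul, Pi.single_apply]
    refine Eq.trans (integral_congr_ae <| .of_forall fun ω => ?_)
      (integral_exp_sum_int_mul_of_isUniform (fun i => R.measurable_phase i.1 i.2) R.phase_iIndep
        (fun i => R.phase_uniform i.1 i.2) hne)
    simp only [phaseFactor, Pi.sub_apply, Int.cast_sub, sub_mul, Finset.sum_sub_distrib, hphase,
      Complex.star_def, ← Complex.exp_conj, map_mul, Complex.conj_I, Complex.conj_ofReal,
      ← Complex.exp_add]
    push_cast
    ring_nf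

/-- The direction of arrival (azimuth, elevation) of a ray. -/
def direction (R : RayModel P μ ν L C S) (l : Fin L) (r : Fin C × Fin S) (ω : Ω) : ℝ × ℝ :=
  (R.azimuth l r ω, R.elevation l r ω)

theorem measurable_direction (R : RayModel P μ ν L C S) (l : Fin L) (r : Fin C × Fin S) :
    Measurable (R.direction l r) :=
  (R.measurable_azimuth l r).prodMk (R.measurable_elevation l r)

theorem hasLaw_direction [IsFiniteMeasure P] (R : RayModel P μ ν L C S) {l l' : Fin L}
    (hll' : l ≠ l') (r : Fin C × Fin S) : HasLaw (R.direction l r) (μ.prod ν) P where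
  aemeasurable := (R.measurable_direction l r).aemeasurable
  map_eq := by
    have hindep : IndepFun (R.azimuth l r) (R.elevation l r) P :=
      (R.angles_iIndep l l' hll' r r).indepFun (i := 0) (j := 1) (by decide)
    exact ((indepFun_iff_map_prod_eq_prod_map_map (R.measurable_azimuth l r).aemeasurable
      (R.measurable_elevation l r).aemeasurable).1 hindep).trans
      (by rw [R.azimuth_law, R.elevation_law])

theorem indepFun_direction (R : RayModel P μ ν L C S) {l l' : Fin L} (hll' : l ≠ l')
    (r r' : Fin C × Fin S) : IndepFun (R.direction l r) (R.direction l' r') P :=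
  (R.angles_iIndep l l' hll' r r').indepFun_prodMk_prodMk
    (by simp [Fin.forall_fin_succ, R.measurable_azimuth, R.measurable_elevation])
    0 1 2 3 (by decide) (by decide) (by decide) (by decide)

section Steering

variable {ι : Type*} [Fintype ι] {a : ℝ → ℝ → ι → ℂ}

/-- The contribution `√β β' a(φ, θ)ᴴ a(φ', θ')` of a ray `p.1` of user `l` and a ray `p.2` of user
`l'` to `h_lᴴ h_{l'}`, apart from its phase factor. -/
noncomputable def rayProduct (R : RayModel P μ ν L C S) (a : ℝ → ℝ → ι → ℂ) (l l' : Fin L)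
    (p : RayPair C S) (ω : Ω) : ℂ :=
  (Real.sqrt (R.power l p.1 * R.power l' p.2) : ℂ) *
    (star (a (R.azimuth l p.1 ω) (R.elevation l p.1 ω)) ⬝ᵥ
      a (R.azimuth l' p.2 ω) (R.elevation l' p.2 ω))

theorem star_channel_dotProduct_channel (R : RayModel P μ ν L C S) (a : ℝ → ℝ → ι → ℂ)
    (l l' : Fin L) (ω : Ω) : star (R.channel a l ω) ⬝ᵥ R.channel a l' ω =
      ∑ p, R.phaseFactor l l' p ω * R.rayProduct a l l' p ω := by
  have hphase : ∀ p : RayPair C S, R.phaseFactor l l' p ω =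
      star (Complex.exp (I * R.phase l p.1 ω)) * Complex.exp (I * R.phase l' p.2 ω) := fun p => by
    rw [phaseFactor, Complex.star_def, ← Complex.exp_conj, ← Complex.exp_add, map_mul,
      Complex.conj_I, Complex.conj_ofReal]
    push_cast
    ring_nf
  simp only [dotProduct, channel, Pi.star_apply, star_sum, Finset.sum_mul_sum]
  simp only [rayProduct, dotProduct, Finset.mul_sum]
  rw [Fintype.sum_prod_type (f := fun p : RayPair C S => ∑ m, _)]
  rw [Finset.sum_comm]
  refine Finset.sum_congr rfl fun r _ => Finset.sum_comm.trans <|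
    Finset.sum_congr rfl fun r' _ => Finset.sum_congr rfl fun m _ => ?_
  simp only [hphase, Real.sqrt_mul (R.power_nonneg l r), star_mul', Complex.star_def,
    Complex.conj_ofReal, Pi.star_apply]
  push_cast
  ring

section SecondMoment

variable (hm : ∀ m, Measurable fun q : ℝ × ℝ => a q.1 q.2 m)
  (ha : ∀ m, MemLp (fun q : ℝ × ℝ => a q.1 q.2 m) 2 (μ.prod ν))

include hm in
theorem indepFun_phaseFactor_rayProduct (R : RayModel P μ ν L C S) (l l' : Fin L) :
    IndepFun (fun ω p => R.phaseFactor l l' p ω) (fun ω p => R.rayProduct a l l' p ω) P := by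
  refine R.phase_indep_angles.comp
    (φ := fun x (p : RayPair C S) => Complex.exp (I * (x (l', p.2) - x (l, p.1) : ℝ)))
    (ψ := fun x (p : RayPair C S) => (Real.sqrt (R.power l p.1 * R.power l' p.2) : ℂ) *
      (star (a (x (l, p.1)).1 (x (l, p.1)).2) ⬝ᵥ a (x (l', p.2)).1 (x (l', p.2)).2))
    (by fun_prop) (measurable_pi_lambda _ fun p => measurable_const.mul ?_)
  exact Finset.measurable_sum _ fun m _ =>
    (continuous_star.measurable.comp ((hm m).comp (measurable_pi_apply _))).mul
      ((hm m).comp (measurable_pi_apply _))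

theorem memLp_two_phaseFactor [IsFiniteMeasure P] (R : RayModel P μ ν L C S) (l l' : Fin L)
    (p : RayPair C S) : MemLp (R.phaseFactor l l' p) 2 P :=
  MemLp.of_bound (R.measurable_phaseFactor l l' p).aestronglyMeasurable 1
    (.of_forall fun ω => (R.norm_phaseFactor l l' p ω).le)

include ha in
theorem memLp_two_rayProduct [IsFiniteMeasure P] (R : RayModel P μ ν L C S) {l l' : Fin L}
    (hll' : l ≠ l') (p : RayPair C S) : MemLp (R.rayProduct a l l' p) 2 P :=
  (memLp_two_star_dotProduct ha (R.hasLaw_direction hll' p.1) (R.hasLaw_direction hll'.symm p.2)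
    (R.indepFun_direction hll' p.1 p.2)).const_mul _

include hm ha in
theorem integrable_interference [IsFiniteMeasure P] (R : RayModel P μ ν L C S) {l l' : Fin L}
    (hll' : l ≠ l') : Integrable (R.interference a l l') P := by
  have hmem : MemLp (fun ω => star (R.channel a l ω) ⬝ᵥ R.channel a l' ω) 2 P := by
    simp only [star_channel_dotProduct_channel]
    exact memLp_two_sum_mul_of_indepFun (R.memLp_two_phaseFactor l l')
      (R.memLp_two_rayProduct ha hll') fun p => (R.indepFun_phaseFactor_rayProduct hm l l').comp
        (measurable_pi_apply p) (measurable_pi_apply p)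
  exact (memLp_two_iff_integrable_sq_norm hmem.1).1 hmem

/-- The correlation `E[a_m conj a_{m'}]` of two antennas, for a direction of arrival with law
`μ ⊗ ν`. -/
noncomputable def antennaCorr (a : ℝ → ℝ → ι → ℂ) (μ ν : Measure ℝ) (m m' : ι) : ℂ :=
  ∫ q, a q.1 q.2 m * star (a q.1 q.2 m') ∂(μ.prod ν)

include ha in
theorem integral_norm_sq_rayProduct [IsFiniteMeasure P] (R : RayModel P μ ν L C S) {l l' : Fin L}
    (hll' : l ≠ l') (p : RayPair C S) : ∫ ω, ‖R.rayProduct a l l' p ω‖ ^ 2 ∂P =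
      R.power l p.1 * R.power l' p.2 * ∑ m, ∑ m', ‖antennaCorr a μ ν m m'‖ ^ 2 := by
  have hpower := mul_nonneg (R.power_nonneg l p.1) (R.power_nonneg l' p.2)
  have hsecond := integral_norm_sq_star_dotProduct (v := fun q => a q.1 q.2) ha
    (R.hasLaw_direction hll' p.1) (R.hasLaw_direction hll'.symm p.2)
    (R.indepFun_direction hll' p.1 p.2)
  simp only [rayProduct, norm_mul, mul_pow, Complex.norm_real, Real.norm_eq_abs, sq_abs,
    Real.sq_sqrt hpower, integral_const_mul, antennaCorr, ← hsecond, direction]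

include hm ha in
theorem integral_interference [IsProbabilityMeasure P] (R : RayModel P μ ν L C S) {l l' : Fin L}
    (hll' : l ≠ l') : ∫ ω, R.interference a l l' ω ∂P =
      R.gain l * R.gain l' * ∑ m, ∑ m', ‖antennaCorr a μ ν m m'‖ ^ 2 := by
  simp only [interference, star_channel_dotProduct_channel]
  rw [integral_norm_sq_sum_mul_of_indepFun (R.memLp_two_phaseFactor l l')
    (R.memLp_two_rayProduct ha hll') (R.indepFun_phaseFactor_rayProduct hm l l')
    (R.integral_phaseFactor_mul_star hll')]
  simp only [R.integral_norm_sq_rayProduct ha hll']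
  rw [gain, gain, Finset.sum_mul_sum, ← Finset.sum_mul, Fintype.sum_prod_type]

include hm ha in
theorem nmi_eq_sum_antennaCorr [IsProbabilityMeasure P] (R : RayModel P μ ν L C S) {l l' : Fin L}
    (hll' : l ≠ l') (hl : 0 < R.gain l) (hl' : 0 < R.gain l') :
    R.nmi a l l' = 1 / (Fintype.card ι : ℝ) ^ 2 * ∑ m, ∑ m', ‖antennaCorr a μ ν m m'‖ ^ 2 := by
  rw [nmi, R.integral_interference hm ha hll', mul_assoc ((Fintype.card ι : ℝ) ^ 2),
    mul_comm (R.gain l * R.gain l'), mul_div_mul_right _ _ (mul_pos hl hl').ne',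
    div_eq_mul_one_div, mul_comm]

end SecondMoment

end Steering

end RayModel

section Arrays

open Complex (I)

theorem arctanQuot_polar (b a : ℝ) :
    (Real.sqrt (a ^ 2 + b ^ 2) * Real.cos (arctanQuot b a) = a ∧
      Real.sqrt (a ^ 2 + b ^ 2) * Real.sin (arctanQuot b a) = b) ∨
    (Real.sqrt (a ^ 2 + b ^ 2) * Real.cos (arctanQuot b a) = -a ∧
      Real.sqrt (a ^ 2 + b ^ 2) * Real.sin (arctanQuot b a) = -b) := by
  rcases eq_or_ne a 0 with rfl | ha
  · rw [zero_pow two_ne_zero, zero_add, Real.sqrt_sq_eq_abs, arctanQuot, if_pos rfl]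
    rcases lt_trichotomy b 0 with hb | rfl | hb
    · simp [sign_neg hb, abs_of_neg hb]
    · simp
    · simp [sign_pos hb, abs_of_pos hb]
  · have hroot : Real.sqrt (1 + (b / a) ^ 2) ≠ 0 := (Real.sqrt_pos.2 (by positivity)).ne'
    have hsqrt : Real.sqrt (a ^ 2 + b ^ 2) = |a| * Real.sqrt (1 + (b / a) ^ 2) := by
      rw [← Real.sqrt_sq_eq_abs, ← Real.sqrt_mul (sq_nonneg a)]
      congr 1
      field_simp
    rw [hsqrt, arctanQuot, if_neg ha, Real.cos_arctan, Real.sin_arctan]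
    rcases ha.lt_or_gt with h | h
    · right
      rw [abs_of_neg h]
      constructor <;> field_simp [hroot]
    · left
      rw [abs_of_pos h]
      constructor <;> field_simp [hroot]

theorem exp_mul_star_exp (x y : ℝ) :
    Complex.exp (I * x) * star (Complex.exp (I * y)) = Complex.exp (I * (x - y : ℝ)) := by
  rw [Complex.star_def, ← Complex.exp_conj, map_mul, Complex.conj_I, Complex.conj_ofReal,
    ← Complex.exp_add]
  push_cast
  ring_nf

theorem star_pairResponse (A z₁ z₂ : ℝ) (q : ℝ × ℝ) :
    star (pairResponse A z₁ z₂ q) = pairResponse A (-z₁) (-z₂) q := by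
  rw [pairResponse, pairResponse, Complex.star_def, ← Complex.exp_conj, map_mul, Complex.conj_I,
    Complex.conj_ofReal]
  push_cast
  ring_nf

theorem norm_integral_pairResponse_neg (ρ : Measure (ℝ × ℝ)) (A z₁ z₂ : ℝ) :
    ‖∫ q, pairResponse A (-z₁) z₂ q ∂ρ‖ = ‖∫ q, pairResponse A z₁ (-z₂) q ∂ρ‖ := by
  rw [← norm_star]
  congr 1
  refine integral_conj.symm.trans (integral_congr_ae <| .of_forall fun q => ?_)
  exact (star_pairResponse A (-z₁) z₂ q).trans (by rw [neg_neg])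

theorem linZ_swap {N : ℕ} (d : ℝ) (m m' : Fin N) : linZ d m' m = -linZ d m m' := by
  unfold linZ
  ring

theorem steerZ_mul_star {Mz : ℕ} (dz θ : ℝ) (k k' : Fin Mz) :
    steerZ Mz dz θ k * star (steerZ Mz dz θ k') =
      Complex.exp (I * (linZ dz k k' * Real.cos θ : ℝ)) := by
  rw [steerZ, steerZ, exp_mul_star_exp, linZ]
  ring_nf

theorem steerY_mul_star {My : ℕ} (dy φ θ : ℝ) (m m' : Fin My) :
    steerY My dy φ θ m * star (steerY My dy φ θ m') =
      Complex.exp (I * (linZ dy m m' * Real.sin θ * Real.sin φ : ℝ)) := by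
  rw [steerY, steerY, exp_mul_star_exp, linZ]
  ring_nf

theorem steerCirc_mul_star {Mr : ℕ} (dr φ θ : ℝ) (m m' : Fin Mr) :
    steerCirc Mr dr φ θ m * star (steerCirc Mr dr φ θ m') =
      Complex.exp (I * (Real.pi * dr / Real.sin (Real.pi / Mr) * Real.sin θ *
        (cylS Mr m m' * Real.sin φ + cylC Mr m m' * Real.cos φ) : ℝ)) := by
  rw [steerCirc, steerCirc, exp_mul_star_exp, cylS, cylC, Real.cos_sub, Real.cos_sub]
  ring_nf

theorem steerVURA_mul_star {My Mz : ℕ} (dy dz : ℝ) (m m' : Fin My × Fin Mz) (q : ℝ × ℝ) :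
    steerVURA My Mz dy dz q.1 q.2 m * star (steerVURA My Mz dy dz q.1 q.2 m') =
      pairResponse 0 (linZ dy m.1 m'.1) (linZ dz m.2 m'.2) q := by
  rw [steerVURA, steerVURA, star_mul', mul_mul_mul_comm, steerY_mul_star, steerZ_mul_star,
    ← Complex.exp_add, ← mul_add, ← Complex.ofReal_add, pairResponse, add_zero]

theorem steerUCylA_mul_star {Mr Mz : ℕ} (dr dz : ℝ) (m m' : Fin Mr × Fin Mz) (q : ℝ × ℝ) :
    steerUCylA Mr Mz dr dz q.1 q.2 m * star (steerUCylA Mr Mz dr dz q.1 q.2 m') =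
      Complex.exp (I * (Real.pi * dr / Real.sin (Real.pi / Mr) * Real.sin q.2 *
        (cylS Mr m.1 m'.1 * Real.sin q.1 + cylC Mr m.1 m'.1 * Real.cos q.1) +
          linZ dz m.2 m'.2 * Real.cos q.2 : ℝ)) := by
  rw [steerUCylA, steerUCylA, star_mul', mul_mul_mul_comm, steerCirc_mul_star, steerZ_mul_star,
    ← Complex.exp_add, ← mul_add, ← Complex.ofReal_add]

theorem steerUCylA_mul_star_eq_pairResponse {Mr : ℕ} (Mz : ℕ) (dr dz : ℝ) (m m' : Fin Mr) :
    (∀ (k k' : Fin Mz) (q : ℝ × ℝ), steerUCylA Mr Mz dr dz q.1 q.2 (m, k) *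
        star (steerUCylA Mr Mz dr dz q.1 q.2 (m', k')) =
      pairResponse (cylA Mr m m') (cylZ₁ Mr dr m m') (linZ dz k k') q) ∨
    (∀ (k k' : Fin Mz) (q : ℝ × ℝ), steerUCylA Mr Mz dr dz q.1 q.2 (m, k) *
        star (steerUCylA Mr Mz dr dz q.1 q.2 (m', k')) =
      pairResponse (cylA Mr m m') (-cylZ₁ Mr dr m m') (linZ dz k k') q) := by
  simp only [steerUCylA_mul_star, pairResponse, cylZ₁, cylA, Real.sin_add]
  refine (arctanQuot_polar (cylC Mr m m') (cylS Mr m m')).imp ?_ ?_ <;>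
    rintro ⟨hcos, hsin⟩ k k' q <;> congr 3
  · linear_combination
      -(Real.pi * dr / Real.sin (Real.pi / Mr) * Real.sin q.2) *
        (Real.sin q.1 * hcos + Real.cos q.1 * hsin)
  · linear_combination
      (Real.pi * dr / Real.sin (Real.pi / Mr) * Real.sin q.2) *
        (Real.sin q.1 * hcos + Real.cos q.1 * hsin)

theorem measurable_steerUCylA {Mr Mz : ℕ} (dr dz : ℝ) (m : Fin Mr × Fin Mz) :
    Measurable fun q : ℝ × ℝ => steerUCylA Mr Mz dr dz q.1 q.2 m := by
  unfold steerUCylA steerCirc steerZ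
  fun_prop

theorem measurable_steerVURA {My Mz : ℕ} (dy dz : ℝ) (m : Fin My × Fin Mz) :
    Measurable fun q : ℝ × ℝ => steerVURA My Mz dy dz q.1 q.2 m := by
  unfold steerVURA steerY steerZ
  fun_prop

theorem norm_steerUCylA {Mr Mz : ℕ} (dr dz φ θ : ℝ) (m : Fin Mr × Fin Mz) :
    ‖steerUCylA Mr Mz dr dz φ θ m‖ = 1 := by
  rw [steerUCylA, steerCirc, steerZ, norm_mul, norm_exp_I_mul_ofReal, norm_exp_I_mul_ofReal,
    one_mul]

theorem norm_steerVURA {My Mz : ℕ} (dy dz φ θ : ℝ) (m : Fin My × Fin Mz) :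
    ‖steerVURA My Mz dy dz φ θ m‖ = 1 := by
  rw [steerVURA, steerY, steerZ, norm_mul, norm_exp_I_mul_ofReal, norm_exp_I_mul_ofReal, one_mul]

section Interference

variable {μ ν : Measure ℝ} [IsFiniteMeasure μ] [IsFiniteMeasure ν]

theorem memLp_two_steerUCylA {Mr Mz : ℕ} (dr dz : ℝ) (m : Fin Mr × Fin Mz) :
    MemLp (fun q : ℝ × ℝ => steerUCylA Mr Mz dr dz q.1 q.2 m) 2 (μ.prod ν) :=
  MemLp.of_bound (measurable_steerUCylA dr dz m).aestronglyMeasurable 1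
    (.of_forall fun q => (norm_steerUCylA dr dz q.1 q.2 m).le)

theorem memLp_two_steerVURA {My Mz : ℕ} (dy dz : ℝ) (m : Fin My × Fin Mz) :
    MemLp (fun q : ℝ × ℝ => steerVURA My Mz dy dz q.1 q.2 m) 2 (μ.prod ν) :=
  MemLp.of_bound (measurable_steerVURA dy dz m).aestronglyMeasurable 1
    (.of_forall fun q => (norm_steerVURA dy dz q.1 q.2 m).le)

theorem antennaCorr_steerVURA (hν : ∀ᵐ θ ∂ν, θ ∈ Set.Ioo 0 Real.pi) {My Mz : ℕ} (dy dz : ℝ)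
    (m m' : Fin My × Fin Mz) : RayModel.antennaCorr (steerVURA My Mz dy dz) μ ν m m' =
      vSeries μ ν 0 (linZ dy m.1 m'.1) (linZ dz m.2 m'.2) := by
  simp only [RayModel.antennaCorr, steerVURA_mul_star, vSeries_eq_integral hν]

-- The principal value of `arctan (b / a)` determines `z₁` only up to sign; conjugation turns the
-- sign of `z₁` into that of `z₂`, that is, into an exchange of the two heights.
theorem sum_antennaCorr_steerUCylA (hν : ∀ᵐ θ ∂ν, θ ∈ Set.Ioo 0 Real.pi) {Mr Mz : ℕ} (dr dz : ℝ)
    (m m' : Fin Mr) : ∑ k, ∑ k',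
      ‖RayModel.antennaCorr (steerUCylA Mr Mz dr dz) μ ν (m, k) (m', k')‖ ^ 2 =
    ∑ k, ∑ k', ‖vSeries μ ν (cylA Mr m m') (cylZ₁ Mr dr m m') (linZ (N := Mz) dz k k')‖ ^ 2 := by
  simp only [RayModel.antennaCorr, vSeries_eq_integral hν]
  rcases steerUCylA_mul_star_eq_pairResponse Mz dr dz m m' with h | h
  · simp only [h]
  · rw [Finset.sum_comm]
    simp only [h, norm_integral_pairResponse_neg, ← linZ_swap]

theorem sum_prod_sum_prod {α β M : Type*} [Fintype α] [Fintype β] [AddCommMonoid M]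
    (f : α × β → α × β → M) :
    ∑ p, ∑ q, f p q = ∑ a, ∑ a', ∑ b, ∑ b', f (a, b) (a', b') := by
  simp only [Fintype.sum_prod_type]
  exact Finset.sum_congr rfl fun a _ => Finset.sum_comm

variable {Ω : Type*} [MeasurableSpace Ω] {P : Measure Ω} [IsProbabilityMeasure P] {L C S : ℕ}
  {l l' : Fin L}

theorem RayModel.nmi_steerVURA (R : RayModel P μ ν L C S) (hν : ∀ᵐ θ ∂ν, θ ∈ Set.Ioo 0 Real.pi)
    (hll' : l ≠ l') (hl : 0 < R.gain l) (hl' : 0 < R.gain l') (My Mz : ℕ) (dy dz : ℝ) :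
    R.nmi (steerVURA My Mz dy dz) l l' = 1 / ((My * Mz : ℕ) : ℝ) ^ 2 *
      ∑ my : Fin My, ∑ my' : Fin My, ∑ mz : Fin Mz, ∑ mz' : Fin Mz,
        ‖vSeries μ ν 0 (linZ dy my my') (linZ dz mz mz')‖ ^ 2 := by
  simp only [R.nmi_eq_sum_antennaCorr (measurable_steerVURA dy dz) (memLp_two_steerVURA dy dz)
    hll' hl hl', sum_prod_sum_prod, antennaCorr_steerVURA hν, Fintype.card_prod, Fintype.card_fin]

theorem RayModel.nmi_steerUCylA (R : RayModel P μ ν L C S) (hν : ∀ᵐ θ ∂ν, θ ∈ Set.Ioo 0 Real.pi)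
    (hll' : l ≠ l') (hl : 0 < R.gain l) (hl' : 0 < R.gain l') (Mr Mz : ℕ) (dr dz : ℝ) :
    R.nmi (steerUCylA Mr Mz dr dz) l l' = 1 / ((Mr * Mz : ℕ) : ℝ) ^ 2 *
      ∑ mr : Fin Mr, ∑ mr' : Fin Mr, ∑ mz : Fin Mz, ∑ mz' : Fin Mz,
        ‖vSeries μ ν (cylA Mr mr mr') (cylZ₁ Mr dr mr mr') (linZ dz mz mz')‖ ^ 2 := by
  simp only [R.nmi_eq_sum_antennaCorr (measurable_steerUCylA dr dz) (memLp_two_steerUCylA dr dz)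
    hll' hl hl', sum_prod_sum_prod, sum_antennaCorr_steerUCylA hν, Fintype.card_prod,
    Fintype.card_fin]

end Interference

end Arrays

section Main

variable {Ω : Type*} [MeasurableSpace Ω] {P : Measure Ω} [IsProbabilityMeasure P] {μ ν : Measure ℝ}
  {L C S : ℕ}

theorem RayModel.isProbabilityMeasure_azimuth_law (R : RayModel P μ ν L C S) (l : Fin L)
    (r : Fin C × Fin S) : IsProbabilityMeasure μ :=
  R.azimuth_law l r ▸ Measure.isProbabilityMeasure_map (R.measurable_azimuth l r).aemeasurable

theorem RayModel.isProbabilityMeasure_elevation_law (R : RayModel P μ ν L C S) (l : Fin L)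
    (r : Fin C × Fin S) : IsProbabilityMeasure ν :=
  R.elevation_law l r ▸ Measure.isProbabilityMeasure_map (R.measurable_elevation l r).aemeasurable

theorem ae_mem_Ioo_of_absolutelyContinuous {ρ : Measure ℝ} (hρ : ρ ≪ volume) {a b : ℝ}
    (h : ∀ᵐ x ∂ρ, x ∈ Set.Icc a b) : ∀ᵐ x ∂ρ, x ∈ Set.Ioo a b := by
  filter_upwards [h, hρ.ae_le (Measure.ae_ne volume a), hρ.ae_le (Measure.ae_ne volume b)]
    with x hx hxa hxb
  exact ⟨hx.1.lt_of_ne' hxa, hx.2.lt_of_ne hxb⟩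

end Main

theorem lemma1_general {Ω : Type*} [MeasurableSpace Ω] (P : Measure Ω) [IsProbabilityMeasure P]
    (μ ν : Measure ℝ) (hν : ∀ᵐ θ ∂ν, θ ∈ Set.Ioo 0 Real.pi)
    {L C S : ℕ} (R : RayModel P μ ν L C S) (l l' : Fin L) (hll' : l ≠ l')
    (hl : 0 < R.gain l) (hl' : 0 < R.gain l') :
    (∀ A z₁ z₂ : ℝ, VConverges μ ν A z₁ z₂) ∧
    (∀ (Mr Mz : ℕ) (dr dz : ℝ), 2 ≤ Mr → 1 ≤ Mz →
      Integrable (R.interference (steerUCylA Mr Mz dr dz) l l') P ∧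
      R.nmi (steerUCylA Mr Mz dr dz) l l' =
        1 / ((Mr * Mz : ℕ) : ℝ) ^ 2 *
          ∑ mr : Fin Mr, ∑ mr' : Fin Mr, ∑ mz : Fin Mz, ∑ mz' : Fin Mz,
            ‖vSeries μ ν (cylA Mr mr mr') (cylZ₁ Mr dr mr mr') (linZ dz mz mz')‖ ^ 2) ∧
    (∀ (My Mz : ℕ) (dy dz : ℝ), 1 ≤ My → 1 ≤ Mz →
      Integrable (R.interference (steerVURA My Mz dy dz) l l') P ∧
      R.nmi (steerVURA My Mz dy dz) l l' =
        1 / ((My * Mz : ℕ) : ℝ) ^ 2 *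
          ∑ my : Fin My, ∑ my' : Fin My, ∑ mz : Fin Mz, ∑ mz' : Fin Mz,
            ‖vSeries μ ν 0 (linZ dy my my') (linZ dz mz mz')‖ ^ 2) := by
  obtain ⟨r, -, -⟩ := Finset.exists_ne_zero_of_sum_ne_zero hl.ne'
  have := R.isProbabilityMeasure_azimuth_law l r
  have := R.isProbabilityMeasure_elevation_law l r
  refine ⟨vConverges hν,
    fun Mr Mz dr dz _ _ => ⟨?_, R.nmi_steerUCylA hν hll' hl hl' Mr Mz dr dz⟩,
    fun My Mz dy dz _ _ => ⟨?_, R.nmi_steerVURA hν hll' hl hl' My Mz dy dz⟩⟩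
  · exact R.integrable_interference (measurable_steerUCylA dr dz) (memLp_two_steerUCylA dr dz) hll'
  · exact R.integrable_interference (measurable_steerVURA dy dz) (memLp_two_steerVURA dy dz) hll'

theorem lemma1 {Ω : Type*} [MeasurableSpace Ω] (P : Measure Ω) [IsProbabilityMeasure P]
    (μ ν : Measure ℝ)
    (hν : ν ≪ volume) (hνπ : ∀ᵐ θ ∂ν, θ ∈ Set.Icc 0 Real.pi)
    {L C S : ℕ} (R : RayModel P μ ν L C S) (l l' : Fin L) (hll' : l ≠ l')
    (hl : 0 < R.gain l) (hl' : 0 < R.gain l') :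
    (∀ A z₁ z₂ : ℝ, VConverges μ ν A z₁ z₂) ∧
    (∀ (Mr Mz : ℕ) (dr dz : ℝ), 2 ≤ Mr → 1 ≤ Mz →
      Integrable (R.interference (steerUCylA Mr Mz dr dz) l l') P ∧
      R.nmi (steerUCylA Mr Mz dr dz) l l' =
        1 / ((Mr * Mz : ℕ) : ℝ) ^ 2 *
          ∑ mr : Fin Mr, ∑ mr' : Fin Mr, ∑ mz : Fin Mz, ∑ mz' : Fin Mz,
            ‖vSeries μ ν (cylA Mr mr mr') (cylZ₁ Mr dr mr mr') (linZ dz mz mz')‖ ^ 2) ∧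
    (∀ (My Mz : ℕ) (dy dz : ℝ), 1 ≤ My → 1 ≤ Mz →
      Integrable (R.interference (steerVURA My Mz dy dz) l l') P ∧
      R.nmi (steerVURA My Mz dy dz) l l' =
        1 / ((My * Mz : ℕ) : ℝ) ^ 2 *
          ∑ my : Fin My, ∑ my' : Fin My, ∑ mz : Fin Mz, ∑ mz' : Fin Mz,
            ‖vSeries μ ν 0 (linZ dy my my') (linZ dz mz mz')‖ ^ 2) :=
  lemma1_general P μ ν (ae_mem_Ioo_of_absolutelyContinuous hν hνπ) R l l' hll' hl hl'
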